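/- An arithmetic universe (AU) is a category with canonically chosen terminal object, pullbacks, initial object, pushouts and parametrized list objects, in which finite colimits are stable under pullback, every arrow that is both mono and epi is invertible, and every equivalence relation is the kernel pair of its coequalizer. A strict AU-functor is a functor preserving all the chosen structure up to equality. An AU-sketch $T$ is a reflexive graph of nodes and edges, together with commutativities (triangles $uv\sim w$ of edges, in diagrammatic order) and universals that declare given nodes and edges to be a terminal object, initial object, pullback cone, pushout cocone, or list object (with $\varepsilon\colon 1\to L$ and $\mathrm{cons}\colon A\times L\to L$). Sketch homomorphisms are the structure-preserving families of maps; two of them count as equal if they agree on nodes and edges. A strict model of $T$ in an AU $\mathcal A$ interprets nodes and edges as objects and arrows of $\mathcal A$ so that domains, codomains, identities and commutativities hold and every universal is interpreted by the canonically chosen structure, all up to equality. For a homomorphism $e\colon T\to T'$ and a strict model $M'$ of $T'$, the reduct $M'|e$ is the strict model of $T$ obtained by composing with $e$. The AU presented by $T$, $\mathrm{AU}\langle T\rangle$, carries a generic strict model of $T$ such that every strict model of $T$ in an AU $\mathcal A$ is the image of the generic one under a unique strict AU-functor $\mathrm{AU}\langle T\rangle\to\mathcal A$; and $\mathrm{AU}\langle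 e\rangle\colon\mathrm{AU}\langle T\rangle\to\mathrm{AU}\langle T'\rangle$ is the strict AU-functor corresponding to the reduct along $e$ of the generic model of $T'$. A protoextension is a sketch homomorphism that on each carrier is a coproduct injection with finite complement (the delta). A simple equivalence extension is a protoextension that adjoins freely, to data present in $T$, exactly one of the following: an edge $w$ with $uv\sim w$, for composable $u,v$; a commutativity given by a unit law or by associativity; a fresh universal (terminal, initial, pullback, pushout or list) with its fresh nodes, edges and commutativities; a fillin for a universal of $T$ (including the recursively defined edge for a list universal), with its defining commutativities; a commutativity $w\sim w'$ (that is, $\mathrm{id}\,w\sim w'$) between two fillins of the same data; or an inverse $u^{-1}$, with $uu^{-1}\sim\mathrm{id}$ and $u^{-1}u\sim\mathrm{id}$, where $u$ is an edge that the data of $T$ exhibit as (i) mono and epi, (ii) an edge into an initial object, (iii) the comparison edge from the pushout of the pulled-back span to the pullback of a pushout, or (iv) the comparison edge from an equivalence relation to the kernel pair of its coequalizer. An equivalence extension is a protoextension that is equal to a composite of finitely many simple equivalence extensions. Theorem. Let $e\colon T\to T'$ be an equivalence extension of AU-sketches. Then (1) for every AU $\mathcal A$ and every strict model $M$ of $T$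 in $\mathcal A$ there is a unique strict model $M'$ of $T'$ in $\mathcal A$ with $M'|e=M$; and (2) the strict AU-functor $\mathrm{AU}\langle e\rangle\colon\mathrm{AU}\langle T\rangle\to\mathrm{AU}\langle T'\rangle$ is an isomorphism. -/

import Mathlib

open CategoryTheory

universe u v

namespace ArithUniv

/-! ## Graphs with distinguished diagrams

A common language for the configurations of nodes and edges that occur both in sketches and in
arithmetic universes.  All triangles are written in diagrammatic order. -/

/-- A graph with identities in which some diagrams are marked:
* `Comm u v w`: the triangle `uv = w` is marked as commutative;
* `IsOne X`, `IsZero X`: `X` is marked as terminal, initial;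
* `Pb u v p q`: `p`, `q` are marked as the two projections of the pullback of `u` and `v`;
* `Po u v i j`: `i`, `j` are marked as the two injections of the pushout of `u` and `v`;
* `Lst π₁ π₂ ε c`: `ε : 1 ⟶ L` and `c : P ⟶ L` are marked as the structure maps of a list object
  `L` of `A`, where `π₁ : P ⟶ A` and `π₂ : P ⟶ L` are the projections of the product of `A` and `L`.
-/
structure Diag where
  N : Type u
  E : Type u
  dom : E → N
  cod : E → N
  id : N → E
  Comm : E → E → E → Prop
  IsOne : N → Prop
  IsZero : N → Prop
  Pb : E → E → E → E → Prop
  Po : E → E → E → E → Prop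
  Lst : E → E → E → E → Prop

namespace Diag

/-- `p`, `q` are marked as projections of a product of `X` and `Y`: a pullback over a terminal. -/
def IsProd (D : Diag.{u}) (X Y : D.N) (p q : D.E) : Prop :=
  ∃ u v, D.dom u = X ∧ D.dom v = Y ∧ D.IsOne (D.cod u) ∧ D.Pb u v p q

/-- `i`, `j` are marked as injections of a coproduct of `X` and `Y`: a pushout under an initial. -/
def IsCoprod (D : Diag.{u}) (X Y : D.N) (i j : D.E) : Prop :=
  ∃ u v, D.cod u = X ∧ D.cod v = Y ∧ D.IsZero (D.dom u) ∧ D.Po u v i j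

/-- `u ∼ u'`: the unary commutativity `id(X) u = u'`. -/
def Eqv (D : Diag.{u}) (u u' : D.E) : Prop := D.Comm (D.id (D.dom u)) u u'

/-- `u` has a two-sided inverse. -/
def Invertible (D : Diag.{u}) (u : D.E) : Prop :=
  ∃ v, D.Comm u v (D.id (D.dom u)) ∧ D.Comm v u (D.id (D.cod u))

/-- An edge `u` marked as monic (its two kernel pair projections agree) and as epi (its two
cokernel pair injections agree). -/
structure BalanceConfig (D : Diag.{u}) where
  (u p q i j : D.E)
  ker : D.Pb u u p q
  mono : D.Eqv p q
  coker : D.Po u u i j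
  epi : D.Eqv i j

/-- The configuration for stability of pushouts.  The pushout `v₁`, `v₂` of `u₁`, `u₂`, with
diagonal `v`, is pulled back along `x`: the pullbacks of `x` with `v₁`, `v₂` and `v` have
projections `(v₁', s₁)`, `(v₂', s₂)` and `(z, s)`; `uᵢ'` is the pullback of `uᵢ`; and `e` is the
comparison from the pushout of `u₁'`, `u₂'` (with injections `j₁`, `j₂`) to the domain of `x`. -/
structure PushoutStabConfig (D : Diag.{u}) where
  (u₁ u₂ v₁ v₂ v x v₁' s₁ v₂' s₂ z s t₁ t₂ u₁' u₂' j₁ j₂ e : D.E)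
  po : D.Po u₁ u₂ v₁ v₂
  diag₁ : D.Comm u₁ v₁ v
  diag₂ : D.Comm u₂ v₂ v
  cod_x : D.cod x = D.cod v
  pb₁ : D.Pb x v₁ v₁' s₁
  pb₂ : D.Pb x v₂ v₂' s₂
  pb : D.Pb x v z s
  su₁ : D.Comm s u₁ t₁
  su₂ : D.Comm s u₂ t₂
  fill₁ : D.Comm u₁' v₁' z
  fill₁' : D.Comm u₁' s₁ t₁
  fill₂ : D.Comm u₂' v₂' z
  fill₂' : D.Comm u₂' s₂ t₂
  po' : D.Po u₁' u₂' j₁ j₂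
  comparison₁ : D.Comm j₁ e v₁'
  comparison₂ : D.Comm j₂ e v₂'

/-- The configuration for exactness: an equivalence relation `π₁, π₂ : X₁ ⟶ X₀`, its coequalizer
`γ`, and the comparison `e` from `X₁` to the kernel pair `k₁`, `k₂` of `γ`. -/
structure ExactConfig (D : Diag.{u}) where
  (π₁ π₂ ρ₁ ρ₂ π κ₁ κ₂ r s p₁ p₂ t t₁ t₂ in₀ in₁ f₁ f₂ γ γ' k₁ k₂ e : D.E)
  /-- `ρ₁`, `ρ₂` are the projections of `X₀ × X₀`, and `π` is the pairing of `π₁` and `π₂` -/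
  prod : D.IsProd (D.cod π₁) (D.cod π₁) ρ₁ ρ₂
  pair₁ : D.Comm π ρ₁ π₁
  pair₂ : D.Comm π ρ₂ π₂
  /-- `π` is monic -/
  ker : D.Pb π π κ₁ κ₂
  mono : D.Eqv κ₁ κ₂
  /-- reflexivity -/
  refl₁ : D.Comm r π₁ (D.id (D.cod π₁))
  refl₂ : D.Comm r π₂ (D.id (D.cod π₁))
  /-- symmetry -/
  symm₁ : D.Comm s π₁ π₂
  symm₂ : D.Comm s π₂ π₁
  /-- transitivity: `t` is defined on the pullback `X₂` of `π₂` and `π₁`, with projections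
  `p₁`, `p₂` -/
  comp : D.Pb π₂ π₁ p₁ p₂
  trans₁ : D.Comm p₁ π₁ t₁
  trans₁' : D.Comm t π₁ t₁
  trans₂ : D.Comm p₂ π₂ t₂
  trans₂' : D.Comm t π₂ t₂
  /-- `in₀`, `in₁` are the injections of a coproduct of `X₀` and `X₁` (taken in either order),
  `f₁ = [id, π₁]`, `f₂ = [id, π₂]`, and the coequalizer `γ` of `π₁`, `π₂` is an injection of the
  pushout of `f₁` and `f₂` -/
  coprod : D.IsCoprod (D.cod π₁) (D.dom π₁) in₀ in₁ ∨ D.IsCoprod (D.dom π₁) (D.cod π₁) in₁ in₀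
  copair₁ : D.Comm in₀ f₁ (D.id (D.cod π₁))
  copair₁' : D.Comm in₁ f₁ π₁
  copair₂ : D.Comm in₀ f₂ (D.id (D.cod π₁))
  copair₂' : D.Comm in₁ f₂ π₂
  coeq : D.Po f₁ f₂ γ γ'
  /-- `e` is the fillin to the kernel pair of `γ` -/
  kernelPair : D.Pb γ γ k₁ k₂
  fill₁ : D.Comm e k₁ π₁
  fill₂ : D.Comm e k₂ π₂

/-- The configuration for recursion on a list object `L` of `A`, with parameter object `B`:
edges `y : B ⟶ Y` and `g : A × Y ⟶ Y`, and what is needed to state the recursion equations. -/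
structure ListConfig (D : Diag.{u}) where
  /-- the list object -/
  (π₁ π₂ ε c : D.E)
  lst : D.Lst π₁ π₂ ε c
  (y g : D.E)
  /-- projections of `L × B`, `(A × L) × B`, `A × (L × B)` and `A × Y` -/
  (l₁ l₂ q₁ q₂ a₁ a₂ m₁ m₂ : D.E)
  prodLB : D.IsProd (D.cod π₂) (D.dom y) l₁ l₂
  prodALB : D.IsProd (D.dom π₁) (D.dom y) q₁ q₂
  prodALB' : D.IsProd (D.cod π₁) (D.dom l₁) a₁ a₂
  prodAY : D.IsProd (D.cod π₁) (D.cod y) m₁ m₂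
  dom_g : D.dom g = D.dom m₁
  cod_g : D.cod g = D.cod y
  /-- `n = ⟨ε !_B, B⟩ : B ⟶ L × B` -/
  (bang k n : D.E)
  bang_ε : D.Comm bang ε k
  n_l₁ : D.Comm n l₁ k
  n_l₂ : D.Comm n l₂ (D.id (D.dom y))
  /-- `cB = c × B : (A × L) × B ⟶ L × B` -/
  (x cB : D.E)
  q₁_c : D.Comm q₁ c x
  cB_l₁ : D.Comm cB l₁ x
  cB_l₂ : D.Comm cB l₂ q₂
  /-- `α` is the associativity isomorphism `(A × L) × B ⟶ A × (L × B)` -/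
  (s z b α : D.E)
  q₁_π₁ : D.Comm q₁ π₁ s
  q₁_π₂ : D.Comm q₁ π₂ z
  b_l₁ : D.Comm b l₁ z
  b_l₂ : D.Comm b l₂ q₂
  α_a₁ : D.Comm α a₁ s
  α_a₂ : D.Comm α a₂ b

/-- `r : L × B ⟶ Y` satisfies the recursion equations `r([], b) = y(b)` and
`r(a : l, b) = g(a, r(l, b))`, with auxiliary edges `r' = A × r`, `r'' = r ∘ a₂`, `g' = g ∘ r'` and
`g'' = r ∘ (c × B)`. -/
structure ListConfig.IsSolution {D : Diag.{u}} (κ : ListConfig D) (r r' r'' g' g'' : D.E) :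
    Prop where
  nil : D.Comm κ.n r κ.y
  cons : D.Comm κ.cB r g''
  cons' : D.Comm κ.α g' g''
  step : D.Comm r' κ.g g'
  snd : D.Comm κ.a₂ r r''
  fst' : D.Comm r' κ.m₁ κ.a₁
  snd' : D.Comm r' κ.m₂ r''

/-- `r` is a solution of the recursion equations. -/
def ListConfig.IsRec {D : Diag.{u}} (κ : ListConfig D) (r : D.E) : Prop :=
  ∃ r' r'' g' g'', κ.IsSolution r r' r'' g' g''

/-- Maps of graphs preserving all marked diagrams. -/
structure Hom (D : Diag.{u}) (D' : Diag.{v}) where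
  node : D.N → D'.N
  edge : D.E → D'.E
  dom : ∀ f, D'.dom (edge f) = node (D.dom f)
  cod : ∀ f, D'.cod (edge f) = node (D.cod f)
  id : ∀ X, D'.id (node X) = edge (D.id X)
  comm : ∀ {f g h}, D.Comm f g h → D'.Comm (edge f) (edge g) (edge h)
  one : ∀ {X}, D.IsOne X → D'.IsOne (node X)
  zero : ∀ {X}, D.IsZero X → D'.IsZero (node X)
  pb : ∀ {a b c d}, D.Pb a b c d → D'.Pb (edge a) (edge b) (edge c) (edge d)
  po : ∀ {a b c d}, D.Po a b c d → D'.Po (edge a) (edge b) (edge c) (edge d)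
  lst : ∀ {a b c d}, D.Lst a b c d → D'.Lst (edge a) (edge b) (edge c) (edge d)

namespace Hom

variable {D : Diag.{u}} {D' : Diag.{v}} (F : Hom D D')

theorem isProd {X Y : D.N} {p q : D.E} (h : D.IsProd X Y p q) :
    D'.IsProd (F.node X) (F.node Y) (F.edge p) (F.edge q) := by
  obtain ⟨a, b, rfl, rfl, h1, h2⟩ := h
  exact ⟨F.edge a, F.edge b, F.dom _, F.dom _, by rw [F.cod]; exact F.one h1, F.pb h2⟩

theorem isCoprod {X Y : D.N} {p q : D.E} (h : D.IsCoprod X Y p q) :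
    D'.IsCoprod (F.node X) (F.node Y) (F.edge p) (F.edge q) := by
  obtain ⟨a, b, rfl, rfl, h1, h2⟩ := h
  exact ⟨F.edge a, F.edge b, F.cod _, F.cod _, by rw [F.dom]; exact F.zero h1, F.po h2⟩

theorem eqv {f g : D.E} (h : D.Eqv f g) : D'.Eqv (F.edge f) (F.edge g) := by
  unfold Eqv; rw [F.dom, F.id]; exact F.comm h

/-- The image of a configuration. -/
def mapBalance (κ : BalanceConfig D) : BalanceConfig D' where
  u := F.edge κ.u
  p := F.edge κ.p
  q := F.edge κ.q
  i := F.edge κ.i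
  j := F.edge κ.j
  ker := F.pb κ.ker
  mono := F.eqv κ.mono
  coker := F.po κ.coker
  epi := F.eqv κ.epi

/-- The image of a configuration. -/
def mapPushoutStab (κ : PushoutStabConfig D) : PushoutStabConfig D' where
  u₁ := F.edge κ.u₁
  u₂ := F.edge κ.u₂
  v₁ := F.edge κ.v₁
  v₂ := F.edge κ.v₂
  v := F.edge κ.v
  x := F.edge κ.x
  v₁' := F.edge κ.v₁'
  s₁ := F.edge κ.s₁
  v₂' := F.edge κ.v₂'
  s₂ := F.edge κ.s₂
  z := F.edge κ.z
  s := F.edge κ.s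
  t₁ := F.edge κ.t₁
  t₂ := F.edge κ.t₂
  u₁' := F.edge κ.u₁'
  u₂' := F.edge κ.u₂'
  j₁ := F.edge κ.j₁
  j₂ := F.edge κ.j₂
  e := F.edge κ.e
  po := F.po κ.po
  diag₁ := F.comm κ.diag₁
  diag₂ := F.comm κ.diag₂
  cod_x := by rw [F.cod, F.cod, κ.cod_x]
  pb₁ := F.pb κ.pb₁
  pb₂ := F.pb κ.pb₂
  pb := F.pb κ.pb
  su₁ := F.comm κ.su₁
  su₂ := F.comm κ.su₂
  fill₁ := F.comm κ.fill₁
  fill₁' := F.comm κ.fill₁'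
  fill₂ := F.comm κ.fill₂
  fill₂' := F.comm κ.fill₂'
  po' := F.po κ.po'
  comparison₁ := F.comm κ.comparison₁
  comparison₂ := F.comm κ.comparison₂

/-- The image of a configuration. -/
def mapExact (κ : ExactConfig D) : ExactConfig D' where
  π₁ := F.edge κ.π₁
  π₂ := F.edge κ.π₂
  ρ₁ := F.edge κ.ρ₁
  ρ₂ := F.edge κ.ρ₂
  π := F.edge κ.π
  κ₁ := F.edge κ.κ₁
  κ₂ := F.edge κ.κ₂
  r := F.edge κ.r
  s := F.edge κ.s
  p₁ := F.edge κ.p₁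
  p₂ := F.edge κ.p₂
  t := F.edge κ.t
  t₁ := F.edge κ.t₁
  t₂ := F.edge κ.t₂
  in₀ := F.edge κ.in₀
  in₁ := F.edge κ.in₁
  f₁ := F.edge κ.f₁
  f₂ := F.edge κ.f₂
  γ := F.edge κ.γ
  γ' := F.edge κ.γ'
  k₁ := F.edge κ.k₁
  k₂ := F.edge κ.k₂
  e := F.edge κ.e
  prod := by rw [F.cod]; exact F.isProd κ.prod
  pair₁ := F.comm κ.pair₁
  pair₂ := F.comm κ.pair₂
  ker := F.pb κ.ker
  mono := F.eqv κ.mono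
  refl₁ := by rw [F.cod, F.id]; exact F.comm κ.refl₁
  refl₂ := by rw [F.cod, F.id]; exact F.comm κ.refl₂
  symm₁ := F.comm κ.symm₁
  symm₂ := F.comm κ.symm₂
  comp := F.pb κ.comp
  trans₁ := F.comm κ.trans₁
  trans₁' := F.comm κ.trans₁'
  trans₂ := F.comm κ.trans₂
  trans₂' := F.comm κ.trans₂'
  coprod := by rw [F.cod, F.dom]; exact κ.coprod.imp F.isCoprod F.isCoprod
  copair₁ := by rw [F.cod, F.id]; exact F.comm κ.copair₁
  copair₁' := F.comm κ.copair₁'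
  copair₂ := by rw [F.cod, F.id]; exact F.comm κ.copair₂
  copair₂' := F.comm κ.copair₂'
  coeq := F.po κ.coeq
  kernelPair := F.pb κ.kernelPair
  fill₁ := F.comm κ.fill₁
  fill₂ := F.comm κ.fill₂

/-- The image of a configuration. -/
def mapList (κ : ListConfig D) : ListConfig D' where
  π₁ := F.edge κ.π₁
  π₂ := F.edge κ.π₂
  ε := F.edge κ.ε
  c := F.edge κ.c
  lst := F.lst κ.lst
  y := F.edge κ.y
  g := F.edge κ.g
  l₁ := F.edge κ.l₁
  l₂ := F.edge κ.l₂
  q₁ := F.edge κ.q₁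
  q₂ := F.edge κ.q₂
  a₁ := F.edge κ.a₁
  a₂ := F.edge κ.a₂
  m₁ := F.edge κ.m₁
  m₂ := F.edge κ.m₂
  prodLB := by rw [F.cod, F.dom]; exact F.isProd κ.prodLB
  prodALB := by rw [F.dom, F.dom]; exact F.isProd κ.prodALB
  prodALB' := by rw [F.cod, F.dom]; exact F.isProd κ.prodALB'
  prodAY := by rw [F.cod, F.cod]; exact F.isProd κ.prodAY
  dom_g := by rw [F.dom, F.dom, κ.dom_g]
  cod_g := by rw [F.cod, F.cod, κ.cod_g]
  bang := F.edge κ.bang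
  k := F.edge κ.k
  n := F.edge κ.n
  bang_ε := F.comm κ.bang_ε
  n_l₁ := F.comm κ.n_l₁
  n_l₂ := by rw [F.dom, F.id]; exact F.comm κ.n_l₂
  x := F.edge κ.x
  cB := F.edge κ.cB
  q₁_c := F.comm κ.q₁_c
  cB_l₁ := F.comm κ.cB_l₁
  cB_l₂ := F.comm κ.cB_l₂
  s := F.edge κ.s
  z := F.edge κ.z
  b := F.edge κ.b
  α := F.edge κ.α
  q₁_π₁ := F.comm κ.q₁_π₁
  q₁_π₂ := F.comm κ.q₁_π₂
  b_l₁ := F.comm κ.b_l₁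
  b_l₂ := F.comm κ.b_l₂
  α_a₁ := F.comm κ.α_a₁
  α_a₂ := F.comm κ.α_a₂

theorem isSolution {κ : ListConfig D} {r r' r'' g' g'' : D.E}
    (h : κ.IsSolution r r' r'' g' g'') :
    (F.mapList κ).IsSolution (F.edge r) (F.edge r') (F.edge r'') (F.edge g') (F.edge g'') :=
  ⟨F.comm h.nil, F.comm h.cons, F.comm h.cons', F.comm h.step, F.comm h.snd, F.comm h.fst',
    F.comm h.snd'⟩

theorem isRec {κ : ListConfig D} {r : D.E} (h : κ.IsRec r) :
    (F.mapList κ).IsRec (F.edge r) := by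
  obtain ⟨_, _, _, _, h⟩ := h
  exact ⟨_, _, _, _, F.isSolution h⟩

end Hom

end Diag

/-! ## Arithmetic universes -/

/-- The operators for a category with canonical choices of a terminal object, pullbacks, an initial
object, pushouts and list objects.  As strict preservation refers to equality of objects, the
arrows form a single sort, and the operators are partial; `comp f g` is `f` followed by `g`. -/
structure AUData where
  Obj : Type u
  Arr : Type u
  dom : Arr → Obj
  cod : Arr → Obj
  id : Obj → Arr
  comp : (f g : Arr) → cod f = dom g → Arr
  one : Obj
  pbFst : (f g : Arr) → cod f = cod g → Arr
  pbSnd : (f g : Arr) → cod f = cod g → Arr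
  zero : Obj
  poInl : (f g : Arr) → dom f = dom g → Arr
  poInr : (f g : Arr) → dom f = dom g → Arr
  nil : Obj → Arr
  cons : Obj → Arr

namespace AUData

/-- The list object of `X`. -/
def list (A : AUData.{u}) (X : A.Obj) : A.Obj := A.cod (A.nil X)

/-- The composite of `f` and `g` is defined and equal to `h`. -/
def Comm (A : AUData.{u}) (f g h : A.Arr) : Prop := ∃ e, A.comp f g e = h

/-- The canonical pullback of `f` and `g` is defined and has projections `p`, `q`. -/
def Pb (A : AUData.{u}) (f g p q : A.Arr) : Prop :=
  ∃ e, A.pbFst f g e = p ∧ A.pbSnd f g e = q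

/-- The canonical pushout of `f` and `g` is defined and has injections `i`, `j`. -/
def Po (A : AUData.{u}) (f g i j : A.Arr) : Prop :=
  ∃ e, A.poInl f g e = i ∧ A.poInr f g e = j

/-- `ε`, `c` are the structure maps of the canonical list object of `A`, and `π₁`, `π₂` are the
projections of the canonical product of `A` and its list object. -/
def Lst (A : AUData.{u}) (π₁ π₂ ε c : A.Arr) : Prop :=
  ∃ X f g, A.dom f = X ∧ A.dom g = A.list X ∧ A.cod f = A.one ∧ A.Pb f g π₁ π₂ ∧
    A.nil X = ε ∧ A.cons X = c

/-- The marked diagrams are those given by the canonical choices. -/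
abbrev toDiag (A : AUData.{u}) : Diag.{u} where
  N := A.Obj
  E := A.Arr
  dom := A.dom
  cod := A.cod
  id := A.id
  Comm := A.Comm
  IsOne X := X = A.one
  IsZero X := X = A.zero
  Pb := A.Pb
  Po := A.Po
  Lst := A.Lst

end AUData

/-- Arithmetic universes with canonical choices of structure: finite limits, stable finite
colimits, balance, exactness, and parametrized list objects. -/
structure AU extends AUData.{u} where
  -- category
  dom_id : ∀ X, dom (id X) = X
  cod_id : ∀ X, cod (id X) = X
  dom_comp : ∀ f g h, dom (comp f g h) = dom f
  cod_comp : ∀ f g h, cod (comp f g h) = cod g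
  id_comp : ∀ f, toAUData.Comm (id (dom f)) f f
  comp_id : ∀ f, toAUData.Comm f (id (cod f)) f
  assoc : ∀ {f g h k l m}, toAUData.Comm f g k → toAUData.Comm g h l →
    toAUData.Comm k h m → toAUData.Comm f l m
  -- terminal object and pullbacks
  one_lift : ∀ X, ∃! f, dom f = X ∧ cod f = one
  pb_cone : ∀ {f g p q}, toAUData.Pb f g p q → ∃ d, toAUData.Comm p f d ∧ toAUData.Comm q g d
  pb_lift : ∀ {f g p q a b d}, toAUData.Pb f g p q → toAUData.Comm a f d → toAUData.Comm b g d →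
    ∃! k, toAUData.Comm k p a ∧ toAUData.Comm k q b
  -- initial object and pushouts
  zero_desc : ∀ X, ∃! f, dom f = zero ∧ cod f = X
  po_cocone : ∀ {f g i j}, toAUData.Po f g i j → ∃ d, toAUData.Comm f i d ∧ toAUData.Comm g j d
  po_desc : ∀ {f g i j a b d}, toAUData.Po f g i j → toAUData.Comm f a d → toAUData.Comm g b d →
    ∃! k, toAUData.Comm i k a ∧ toAUData.Comm j k b
  -- stability
  zero_stable : ∀ f, cod f = zero → toAUData.toDiag.Invertible f
  po_stable : ∀ κ : toAUData.toDiag.PushoutStabConfig, toAUData.toDiag.Invertible κ.e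
  -- balance
  balance : ∀ κ : toAUData.toDiag.BalanceConfig, toAUData.toDiag.Invertible κ.u
  -- exactness
  exact : ∀ κ : toAUData.toDiag.ExactConfig, toAUData.toDiag.Invertible κ.e
  -- list objects
  dom_nil : ∀ X, dom (nil X) = one
  cod_cons : ∀ X, cod (cons X) = toAUData.list X
  dom_cons : ∀ (X : Obj) (p q : Arr), toAUData.toDiag.IsProd X (toAUData.list X) p q → dom (cons X) = dom p
  list_rec : ∀ κ : toAUData.toDiag.ListConfig, ∃! r, κ.IsRec r

/-- Homomorphisms for the operators. -/
@[ext]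
structure AUData.Hom (A : AUData.{u}) (B : AUData.{v}) where
  obj : A.Obj → B.Obj
  arr : A.Arr → B.Arr
  dom : ∀ f, B.dom (arr f) = obj (A.dom f)
  cod : ∀ f, B.cod (arr f) = obj (A.cod f)
  id : ∀ X, arr (A.id X) = B.id (obj X)
  comp : ∀ f g h h', arr (A.comp f g h) = B.comp (arr f) (arr g) h'
  one : obj A.one = B.one
  pbFst : ∀ f g h h', arr (A.pbFst f g h) = B.pbFst (arr f) (arr g) h'
  pbSnd : ∀ f g h h', arr (A.pbSnd f g h) = B.pbSnd (arr f) (arr g) h'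
  zero : obj A.zero = B.zero
  poInl : ∀ f g h h', arr (A.poInl f g h) = B.poInl (arr f) (arr g) h'
  poInr : ∀ f g h h', arr (A.poInr f g h) = B.poInr (arr f) (arr g) h'
  nil : ∀ X, arr (A.nil X) = B.nil (obj X)
  cons : ∀ X, arr (A.cons X) = B.cons (obj X)

namespace AUData.Hom

theorem pb {A : AUData.{u}} {B : AUData.{v}} (F : Hom A B) {a b c d} (h : A.Pb a b c d) :
    B.Pb (F.arr a) (F.arr b) (F.arr c) (F.arr d) := by
  obtain ⟨e, rfl, rfl⟩ := h
  have e' : B.cod (F.arr a) = B.cod (F.arr b) := by rw [F.cod, F.cod, e]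
  exact ⟨e', (F.pbFst _ _ _ _).symm, (F.pbSnd _ _ _ _).symm⟩

theorem po {A : AUData.{u}} {B : AUData.{v}} (F : Hom A B) {a b c d} (h : A.Po a b c d) :
    B.Po (F.arr a) (F.arr b) (F.arr c) (F.arr d) := by
  obtain ⟨e, rfl, rfl⟩ := h
  have e' : B.dom (F.arr a) = B.dom (F.arr b) := by rw [F.dom, F.dom, e]
  exact ⟨e', (F.poInl _ _ _ _).symm, (F.poInr _ _ _ _).symm⟩

theorem comm {A : AUData.{u}} {B : AUData.{v}} (F : Hom A B) {f g h} (H : A.Comm f g h) :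
    B.Comm (F.arr f) (F.arr g) (F.arr h) := by
  obtain ⟨e, rfl⟩ := H
  exact ⟨by rw [F.cod, F.dom, e], (F.comp _ _ _ _).symm⟩

theorem obj_list {A : AUData.{u}} {B : AUData.{v}} (F : Hom A B) (X : A.Obj) :
    F.obj (A.list X) = B.list (F.obj X) := by
  unfold AUData.list; rw [← F.cod, F.nil]

/-- A homomorphism preserves the marked diagrams. -/
abbrev toDiagHom {A : AUData.{u}} {B : AUData.{v}} (F : Hom A B) : Diag.Hom A.toDiag B.toDiag where
  node := F.obj
  edge := F.arr
  dom := F.dom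
  cod := F.cod
  id X := (F.id X).symm
  comm h := F.comm h
  one := by rintro _ rfl; exact F.one
  zero := by rintro _ rfl; exact F.zero
  pb h := F.pb h
  po h := F.po h
  lst := by
    rintro _ _ _ _ ⟨X, f, g, h1, h2, h3, h4, rfl, rfl⟩
    exact ⟨F.obj X, F.arr f, F.arr g, by rw [F.dom, h1], by rw [F.dom, h2, F.obj_list],
      by rw [F.cod, h3, F.one], F.pb h4, (F.nil _).symm, (F.cons _).symm⟩

/-- The identity homomorphism. -/
def refl (A : AUData.{u}) : Hom A A where
  obj X := X
  arr f := f
  dom _ := rfl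
  cod _ := rfl
  id _ := rfl
  comp _ _ _ _ := rfl
  one := rfl
  pbFst _ _ _ _ := rfl
  pbSnd _ _ _ _ := rfl
  zero := rfl
  poInl _ _ _ _ := rfl
  poInr _ _ _ _ := rfl
  nil _ := rfl
  cons _ := rfl

/-- Composition of homomorphisms: `F` followed by `G`. -/
def trans {A B C : AUData.{u}} (F : Hom A B) (G : Hom B C) : Hom A C where
  obj X := G.obj (F.obj X)
  arr f := G.arr (F.arr f)
  dom f := by rw [G.dom, F.dom]
  cod f := by rw [G.cod, F.cod]
  id X := by rw [F.id, G.id]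
  comp f g h h' := by
    have e : B.cod (F.arr f) = B.dom (F.arr g) := by rw [F.cod, F.dom, h]
    rw [F.comp _ _ _ e, G.comp]
  one := by rw [F.one, G.one]
  pbFst f g h h' := by
    have e : B.cod (F.arr f) = B.cod (F.arr g) := by rw [F.cod, F.cod, h]
    rw [F.pbFst _ _ _ e, G.pbFst]
  pbSnd f g h h' := by
    have e : B.cod (F.arr f) = B.cod (F.arr g) := by rw [F.cod, F.cod, h]
    rw [F.pbSnd _ _ _ e, G.pbSnd]
  zero := by rw [F.zero, G.zero]
  poInl f g h h' := by
    have e : B.dom (F.arr f) = B.dom (F.arr g) := by rw [F.dom, F.dom, h]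
    rw [F.poInl _ _ _ e, G.poInl]
  poInr f g h h' := by
    have e : B.dom (F.arr f) = B.dom (F.arr g) := by rw [F.dom, F.dom, h]
    rw [F.poInr _ _ _ e, G.poInr]
  nil X := by rw [F.nil, G.nil]
  cons X := by rw [F.cons, G.cons]

end AUData.Hom

/-- The category of (small) arithmetic universes and strict AU-functors. -/
instance : Category.{u} AU.{u} where
  Hom A B := AUData.Hom A.toAUData B.toAUData
  id A := AUData.Hom.refl A.toAUData
  comp F G := AUData.Hom.trans F G

/-! ## Sketches -/

/-- AU-sketches: nodes, edges, commutativities, and universals for pullbacks, pushouts, terminal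
objects, initial objects and list objects.  A commutativity `τ` is the triangle
`left τ`, `right τ`, `long τ` with `left` followed by `right` equal to `long`. -/
structure Sketch where
  N : Type u
  E : Type u
  Tri : Type u
  UPb : Type u
  UPo : Type u
  UOne : Type u
  UZero : Type u
  UList : Type u
  dom : E → N
  cod : E → N
  id : N → E
  left : Tri → E
  right : Tri → E
  long : Tri → E
  pb₁ : UPb → Tri
  pb₂ : UPb → Tri
  po₁ : UPo → Tri
  po₂ : UPo → Tri
  one : UOne → N
  zero : UZero → N
  lPb : UList → UPb
  lOne : UList → UOne
  lNil : UList → E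
  lCons : UList → E
  dom_id : ∀ X, dom (id X) = X
  cod_id : ∀ X, cod (id X) = X
  cod_left : ∀ τ, cod (left τ) = dom (right τ)
  dom_left : ∀ τ, dom (left τ) = dom (long τ)
  cod_right : ∀ τ, cod (right τ) = cod (long τ)
  long_pb : ∀ ω, long (pb₁ ω) = long (pb₂ ω)
  long_po : ∀ ω, long (po₁ ω) = long (po₂ ω)
  cod_lPb : ∀ ω, cod (long (pb₁ (lPb ω))) = one (lOne ω)
  dom_lNil : ∀ ω, dom (lNil ω) = one (lOne ω)
  dom_lCons : ∀ ω, dom (lCons ω) = dom (left (pb₁ (lPb ω)))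
  cod_lNil : ∀ ω, cod (lNil ω) = cod (left (pb₂ (lPb ω)))
  cod_lCons : ∀ ω, cod (lCons ω) = cod (left (pb₂ (lPb ω)))

namespace Sketch

/-- The commutativity `τ` is the triangle `uv ∼ w`. -/
def IsTri (T : Sketch.{u}) (τ : T.Tri) (u v w : T.E) : Prop :=
  T.left τ = u ∧ T.right τ = v ∧ T.long τ = w

/-- The node `A(ω)` of which a list universal `ω` specifies the list object. -/
def lBase (T : Sketch.{u}) (ω : T.UList) : T.N := T.cod (T.left (T.pb₁ (T.lPb ω)))

/-- The marked diagrams are those given by the commutativities and universals. -/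
abbrev toDiag (T : Sketch.{u}) : Diag.{u} where
  N := T.N
  E := T.E
  dom := T.dom
  cod := T.cod
  id := T.id
  Comm u v w := ∃ τ, T.IsTri τ u v w
  IsOne X := ∃ ω, T.one ω = X
  IsZero X := ∃ ω, T.zero ω = X
  Pb u v p q := ∃ ω, T.right (T.pb₁ ω) = u ∧ T.right (T.pb₂ ω) = v ∧
    T.left (T.pb₁ ω) = p ∧ T.left (T.pb₂ ω) = q
  Po u v i j := ∃ ω, T.left (T.po₁ ω) = u ∧ T.left (T.po₂ ω) = v ∧
    T.right (T.po₁ ω) = i ∧ T.right (T.po₂ ω) = j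
  Lst π₁ π₂ ε c := ∃ ω, T.left (T.pb₁ (T.lPb ω)) = π₁ ∧ T.left (T.pb₂ (T.lPb ω)) = π₂ ∧
    T.lNil ω = ε ∧ T.lCons ω = c

/-- Homomorphisms of sketches. -/
structure Hom (T T' : Sketch.{u}) where
  n : T.N → T'.N
  e : T.E → T'.E
  tri : T.Tri → T'.Tri
  uPb : T.UPb → T'.UPb
  uPo : T.UPo → T'.UPo
  uOne : T.UOne → T'.UOne
  uZero : T.UZero → T'.UZero
  uList : T.UList → T'.UList
  dom : ∀ f, n (T.dom f) = T'.dom (e f)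
  cod : ∀ f, n (T.cod f) = T'.cod (e f)
  id : ∀ X, e (T.id X) = T'.id (n X)
  left : ∀ τ, e (T.left τ) = T'.left (tri τ)
  right : ∀ τ, e (T.right τ) = T'.right (tri τ)
  long : ∀ τ, e (T.long τ) = T'.long (tri τ)
  pb₁ : ∀ ω, tri (T.pb₁ ω) = T'.pb₁ (uPb ω)
  pb₂ : ∀ ω, tri (T.pb₂ ω) = T'.pb₂ (uPb ω)
  po₁ : ∀ ω, tri (T.po₁ ω) = T'.po₁ (uPo ω)
  po₂ : ∀ ω, tri (T.po₂ ω) = T'.po₂ (uPo ω)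
  one : ∀ ω, n (T.one ω) = T'.one (uOne ω)
  zero : ∀ ω, n (T.zero ω) = T'.zero (uZero ω)
  lPb : ∀ ω, uPb (T.lPb ω) = T'.lPb (uList ω)
  lOne : ∀ ω, uOne (T.lOne ω) = T'.lOne (uList ω)
  lNil : ∀ ω, e (T.lNil ω) = T'.lNil (uList ω)
  lCons : ∀ ω, e (T.lCons ω) = T'.lCons (uList ω)

namespace Hom

/-- The identity homomorphism. -/
def refl (T : Sketch.{u}) : Hom T T where
  n X := X
  e f := f
  tri τ := τ
  uPb ω := ω
  uPo ω := ω
  uOne ω := ω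
  uZero ω := ω
  uList ω := ω
  dom _ := rfl
  cod _ := rfl
  id _ := rfl
  left _ := rfl
  right _ := rfl
  long _ := rfl
  pb₁ _ := rfl
  pb₂ _ := rfl
  po₁ _ := rfl
  po₂ _ := rfl
  one _ := rfl
  zero _ := rfl
  lPb _ := rfl
  lOne _ := rfl
  lNil _ := rfl
  lCons _ := rfl

/-- Composition of homomorphisms: `F` followed by `G`. -/
def trans {T₁ T₂ T₃ : Sketch.{u}} (F : Hom T₁ T₂) (G : Hom T₂ T₃) : Hom T₁ T₃ where
  n X := G.n (F.n X)
  e f := G.e (F.e f)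
  tri τ := G.tri (F.tri τ)
  uPb ω := G.uPb (F.uPb ω)
  uPo ω := G.uPo (F.uPo ω)
  uOne ω := G.uOne (F.uOne ω)
  uZero ω := G.uZero (F.uZero ω)
  uList ω := G.uList (F.uList ω)
  dom f := by rw [F.dom, G.dom]
  cod f := by rw [F.cod, G.cod]
  id X := by rw [F.id, G.id]
  left τ := by rw [F.left, G.left]
  right τ := by rw [F.right, G.right]
  long τ := by rw [F.long, G.long]
  pb₁ ω := by rw [F.pb₁, G.pb₁]
  pb₂ ω := by rw [F.pb₂, G.pb₂]
  po₁ ω := by rw [F.po₁, G.po₁]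
  po₂ ω := by rw [F.po₂, G.po₂]
  one ω := by rw [F.one, G.one]
  zero ω := by rw [F.zero, G.zero]
  lPb ω := by rw [F.lPb, G.lPb]
  lOne ω := by rw [F.lOne, G.lOne]
  lNil ω := by rw [F.lNil, G.lNil]
  lCons ω := by rw [F.lCons, G.lCons]

/-- Two sketch homomorphisms count as equal if they agree on nodes and edges. -/
def Agree {T T' : Sketch.{u}} (F G : Hom T T') : Prop := F.n = G.n ∧ F.e = G.e

end Hom

/-! ## Strict models -/

/-- Strict models of a sketch in an arithmetic universe: interpretations of nodes and edges that
satisfy the implied relations of the sketch up to equality. -/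
@[ext]
structure StrictModel (T : Sketch.{u}) (A : AU.{v}) where
  node : T.N → A.Obj
  edge : T.E → A.Arr
  dom : ∀ f, A.dom (edge f) = node (T.dom f)
  cod : ∀ f, A.cod (edge f) = node (T.cod f)
  id : ∀ X, A.id (node X) = edge (T.id X)
  tri : ∀ τ, A.Comm (edge (T.left τ)) (edge (T.right τ)) (edge (T.long τ))
  one : ∀ ω, node (T.one ω) = A.one
  zero : ∀ ω, node (T.zero ω) = A.zero
  pb : ∀ ω, A.Pb (edge (T.right (T.pb₁ ω))) (edge (T.right (T.pb₂ ω)))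
    (edge (T.left (T.pb₁ ω))) (edge (T.left (T.pb₂ ω)))
  po : ∀ ω, A.Po (edge (T.left (T.po₁ ω))) (edge (T.left (T.po₂ ω)))
    (edge (T.right (T.po₁ ω))) (edge (T.right (T.po₂ ω)))
  nil : ∀ ω, A.nil (node (T.lBase ω)) = edge (T.lNil ω)
  cons : ∀ ω, A.cons (node (T.lBase ω)) = edge (T.lCons ω)

namespace StrictModel

/-- The reduct `M|e` of a strict model along a sketch homomorphism. -/
def reduct {T T' : Sketch.{u}} {A : AU.{v}} (M : StrictModel T' A) (e : Hom T T') :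
    StrictModel T A where
  node X := M.node (e.n X)
  edge f := M.edge (e.e f)
  dom f := by rw [M.dom, e.dom]
  cod f := by rw [M.cod, e.cod]
  id X := by rw [M.id, e.id]
  tri τ := by rw [e.left, e.right, e.long]; exact M.tri _
  one ω := by rw [e.one, M.one]
  zero ω := by rw [e.zero, M.zero]
  pb ω := by rw [e.left, e.right, e.left, e.right, e.pb₁, e.pb₂]; exact M.pb _
  po ω := by rw [e.left, e.right, e.left, e.right, e.po₁, e.po₂]; exact M.po _
  nil ω := by
    have h : e.n (T.lBase ω) = T'.lBase (e.uList ω) := by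
      unfold lBase; rw [e.cod, e.left, e.pb₁, e.lPb]
    rw [h, M.nil, e.lNil]
  cons ω := by
    have h : e.n (T.lBase ω) = T'.lBase (e.uList ω) := by
      unfold lBase; rw [e.cod, e.left, e.pb₁, e.lPb]
    rw [h, M.cons, e.lCons]

/-- The image of a strict model under a strict AU-functor. -/
def map {T : Sketch.{u}} {A B : AU.{v}} (M : StrictModel T A) (F : A ⟶ B) :
    StrictModel T B where
  node X := F.obj (M.node X)
  edge f := F.arr (M.edge f)
  dom f := by rw [F.dom, M.dom]
  cod f := by rw [F.cod, M.cod]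
  id X := by rw [← M.id, F.id]
  tri τ := F.comm (M.tri τ)
  one ω := by rw [M.one, F.one]
  zero ω := by rw [M.zero, F.zero]
  pb ω := F.pb (M.pb ω)
  po ω := F.po (M.po ω)
  nil ω := by rw [← M.nil, F.nil]
  cons ω := by rw [← M.cons, F.cons]

end StrictModel

/-! ## Equivalence extensions -/

/-- Finite lists of elements of the carriers of a sketch. -/
structure Delta (T : Sketch.{u}) where
  n : List T.N := []
  e : List T.E := []
  tri : List T.Tri := []
  uPb : List T.UPb := []
  uPo : List T.UPo := []
  uOne : List T.UOne := []
  uZero : List T.UZero := []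
  uList : List T.UList := []

/-- `Y` is the coproduct of `X`, injected by `f`, and of the distinct elements of the list `l`. -/
def IsCoproduct {X Y : Type u} (f : X → Y) (l : List Y) : Prop :=
  Function.Injective f ∧ l.Nodup ∧ ∀ y, y ∈ l ↔ y ∉ Set.range f

namespace Hom

variable {T T' : Sketch.{u}}

/-- `i : T → T'` is a protoextension with delta `d`: on each carrier, `T'` is the coproduct of `T`
and the (distinct) elements of `d`. -/
structure Adjoins (i : Hom T T') (d : Delta T') : Prop where
  n : IsCoproduct i.n d.n
  e : IsCoproduct i.e d.e
  tri : IsCoproduct i.tri d.tri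
  uPb : IsCoproduct i.uPb d.uPb
  uPo : IsCoproduct i.uPo d.uPo
  uOne : IsCoproduct i.uOne d.uOne
  uZero : IsCoproduct i.uZero d.uZero
  uList : IsCoproduct i.uList d.uList

/-- Protoextensions. -/
def IsProtoExtension (i : Hom T T') : Prop := ∃ d, i.Adjoins d

/-- `i` adjoins an inverse of the edge `u`: an edge and two commutativities. -/
def AdjoinsInverse (i : Hom T T') (u : T.E) : Prop :=
  ∃ (u' : T'.E) (τ₁ τ₂ : T'.Tri),
    T'.IsTri τ₁ (i.e u) u' (T'.id (i.n (T.dom u))) ∧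
    T'.IsTri τ₂ u' (i.e u) (T'.id (i.n (T.cod u))) ∧
    i.Adjoins { e := [u'], tri := [τ₁, τ₂] }

/-- `i` adjoins the commutativity `uv ∼ w`. -/
def AdjoinsTri (i : Hom T T') (u v w : T.E) : Prop :=
  ∃ τ, T'.IsTri τ (i.e u) (i.e v) (i.e w) ∧ i.Adjoins { tri := [τ] }

/-- `i` adjoins the unary commutativity `u ∼ u'`. -/
def AdjoinsEqv (i : Hom T T') (u u' : T.E) : Prop := i.AdjoinsTri (T.id (T.dom u)) u u'

/-- The rules for simple equivalence extensions. -/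
inductive IsSimpleEquivExt (i : Hom T T') : Prop
  -- composition
  | comp (u v : T.E) (_ : T.cod u = T.dom v) (x : T'.E) (τ : T'.Tri)
      (_ : T'.IsTri τ (i.e u) (i.e v) x)
      (_ : i.Adjoins { e := [x], tri := [τ] })
  | leftUnit (u : T.E) (_ : i.AdjoinsTri (T.id (T.dom u)) u u)
  | rightUnit (u : T.E) (_ : i.AdjoinsTri u (T.id (T.cod u)) u)
  | leftAssoc (u v x k l m : T.E) (_ : T.toDiag.Comm u v k) (_ : T.toDiag.Comm v x l)
      (_ : T.toDiag.Comm u l m) (_ : i.AdjoinsTri k x m)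
  | rightAssoc (u v x k l m : T.E) (_ : T.toDiag.Comm u v k) (_ : T.toDiag.Comm v x l)
      (_ : T.toDiag.Comm k x m) (_ : i.AdjoinsTri u l m)
  -- terminal objects
  | one (ω : T'.UOne) (X : T'.N) (_ : T'.one ω = X)
      (_ : i.Adjoins { uOne := [ω], n := [X], e := [T'.id X] })
  | oneFill (ω : T.UOne) (X : T.N) (x : T'.E) (_ : T'.dom x = i.n X)
      (_ : T'.cod x = i.n (T.one ω)) (_ : i.Adjoins { e := [x] })
  | oneUnique (ω : T.UOne) (x x' : T.E) (_ : T.dom x = T.dom x') (_ : T.cod x = T.one ω)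
      (_ : T.cod x' = T.one ω) (_ : i.AdjoinsEqv x x')
  -- pullbacks
  | pb (u₁ u₂ : T.E) (_ : T.cod u₁ = T.cod u₂)
      (ω : T'.UPb) (τ₁ τ₂ : T'.Tri) (p₁ p p₂ : T'.E) (P : T'.N)
      (_ : T'.pb₁ ω = τ₁) (_ : T'.pb₂ ω = τ₂)
      (_ : T'.IsTri τ₁ p₁ (i.e u₁) p) (_ : T'.IsTri τ₂ p₂ (i.e u₂) p) (_ : T'.dom p = P)
      (_ : i.Adjoins { uPb := [ω], tri := [τ₁, τ₂], e := [p₁, p, p₂, T'.id P], n := [P] })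
  | pbFill (ω : T.UPb) (Δ₁ Δ₂ : T.Tri) (_ : T.right Δ₁ = T.right (T.pb₁ ω))
      (_ : T.right Δ₂ = T.right (T.pb₂ ω)) (_ : T.long Δ₁ = T.long Δ₂)
      (x : T'.E) (τ₁ τ₂ : T'.Tri)
      (_ : T'.IsTri τ₁ x (i.e (T.left (T.pb₁ ω))) (i.e (T.left Δ₁)))
      (_ : T'.IsTri τ₂ x (i.e (T.left (T.pb₂ ω))) (i.e (T.left Δ₂)))
      (_ : i.Adjoins { e := [x], tri := [τ₁, τ₂] })
  | pbUnique (ω : T.UPb) (v₁ v₂ x x' : T.E)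
      (_ : T.toDiag.Comm x (T.left (T.pb₁ ω)) v₁) (_ : T.toDiag.Comm x (T.left (T.pb₂ ω)) v₂)
      (_ : T.toDiag.Comm x' (T.left (T.pb₁ ω)) v₁) (_ : T.toDiag.Comm x' (T.left (T.pb₂ ω)) v₂)
      (_ : i.AdjoinsEqv x x')
  -- initial objects
  | zero (ω : T'.UZero) (X : T'.N) (_ : T'.zero ω = X)
      (_ : i.Adjoins { uZero := [ω], n := [X], e := [T'.id X] })
  | zeroFill (ω : T.UZero) (X : T.N) (x : T'.E) (_ : T'.dom x = i.n (T.zero ω))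
      (_ : T'.cod x = i.n X) (_ : i.Adjoins { e := [x] })
  | zeroUnique (ω : T.UZero) (x x' : T.E) (_ : T.cod x = T.cod x') (_ : T.dom x = T.zero ω)
      (_ : T.dom x' = T.zero ω) (_ : i.AdjoinsEqv x x')
  -- pushouts
  | po (u₁ u₂ : T.E) (_ : T.dom u₁ = T.dom u₂)
      (ω : T'.UPo) (τ₁ τ₂ : T'.Tri) (q₁ q q₂ : T'.E) (Q : T'.N)
      (_ : T'.po₁ ω = τ₁) (_ : T'.po₂ ω = τ₂)
      (_ : T'.IsTri τ₁ (i.e u₁) q₁ q) (_ : T'.IsTri τ₂ (i.e u₂) q₂ q) (_ : T'.cod q = Q)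
      (_ : i.Adjoins { uPo := [ω], tri := [τ₁, τ₂], e := [q₁, q, q₂, T'.id Q], n := [Q] })
  | poFill (ω : T.UPo) (Δ₁ Δ₂ : T.Tri) (_ : T.left Δ₁ = T.left (T.po₁ ω))
      (_ : T.left Δ₂ = T.left (T.po₂ ω)) (_ : T.long Δ₁ = T.long Δ₂)
      (x : T'.E) (τ₁ τ₂ : T'.Tri)
      (_ : T'.IsTri τ₁ (i.e (T.right (T.po₁ ω))) x (i.e (T.right Δ₁)))
      (_ : T'.IsTri τ₂ (i.e (T.right (T.po₂ ω))) x (i.e (T.right Δ₂)))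
      (_ : i.Adjoins { e := [x], tri := [τ₁, τ₂] })
  | poUnique (ω : T.UPo) (v₁ v₂ x x' : T.E)
      (_ : T.toDiag.Comm (T.right (T.po₁ ω)) x v₁) (_ : T.toDiag.Comm (T.right (T.po₂ ω)) x v₂)
      (_ : T.toDiag.Comm (T.right (T.po₁ ω)) x' v₁) (_ : T.toDiag.Comm (T.right (T.po₂ ω)) x' v₂)
      (_ : i.AdjoinsEqv x x')
  -- list objects
  | list (A : T.N) (ω : T'.UList) (ωOne : T'.UOne) (ωPb : T'.UPb) (τ₁ τ₂ : T'.Tri)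
      (ε c p₁ p p₂ bangA bangL : T'.E) (I L P : T'.N)
      (_ : T'.lOne ω = ωOne) (_ : T'.lPb ω = ωPb) (_ : T'.lNil ω = ε) (_ : T'.lCons ω = c)
      (_ : T'.one ωOne = I) (_ : T'.pb₁ ωPb = τ₁) (_ : T'.pb₂ ωPb = τ₂)
      (_ : T'.IsTri τ₁ p₁ bangA p) (_ : T'.IsTri τ₂ p₂ bangL p)
      (_ : T'.dom bangA = i.n A) (_ : T'.dom bangL = L) (_ : T'.dom p = P)
      (_ : i.Adjoins
        { uList := [ω], uOne := [ωOne], uPb := [ωPb], tri := [τ₁, τ₂],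
          e := [ε, c, p₁, p, p₂, bangA, bangL, T'.id I, T'.id L, T'.id P], n := [I, L, P] })
  | listFill (κ : T.toDiag.ListConfig) (r r' r'' g' g'' : T'.E)
      (τ₁ τ₂ τ₃ τ₄ τ₅ τ₆ τ₇ : T'.Tri)
      (_ : T'.IsTri τ₁ (i.e κ.n) r (i.e κ.y)) (_ : T'.IsTri τ₂ (i.e κ.cB) r g'')
      (_ : T'.IsTri τ₃ (i.e κ.α) g' g'') (_ : T'.IsTri τ₄ r' (i.e κ.g) g')
      (_ : T'.IsTri τ₅ (i.e κ.a₂) r r'') (_ : T'.IsTri τ₆ r' (i.e κ.m₁) (i.e κ.a₁))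
      (_ : T'.IsTri τ₇ r' (i.e κ.m₂) r'')
      (_ : i.Adjoins
        { e := [r, r', r'', g', g''], tri := [τ₁, τ₂, τ₃, τ₄, τ₅, τ₆, τ₇] })
  | listUnique (κ : T.toDiag.ListConfig) (r₁ r₂ : T.E) (_ : κ.IsRec r₁) (_ : κ.IsRec r₂)
      (_ : i.AdjoinsEqv r₁ r₂)
  -- balance, stability, exactness
  | balance (κ : T.toDiag.BalanceConfig) (_ : i.AdjoinsInverse κ.u)
  | zeroStable (ω : T.UZero) (u : T.E) (_ : T.cod u = T.zero ω) (_ : i.AdjoinsInverse u)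
  | poStable (κ : T.toDiag.PushoutStabConfig) (_ : i.AdjoinsInverse κ.e)
  | exact (κ : T.toDiag.ExactConfig) (_ : i.AdjoinsInverse κ.e)

/-- Finite composites of simple equivalence extensions. -/
inductive IsEquivExtComposite : {T T' : Sketch.{u}} → Hom T T' → Prop
  | refl (T : Sketch.{u}) : IsEquivExtComposite (Hom.refl T)
  | step {T₁ T₂ T₃ : Sketch.{u}} (i : Hom T₁ T₂) (j : Hom T₂ T₃) (_ : IsEquivExtComposite i)
      (_ : j.IsSimpleEquivExt) : IsEquivExtComposite (i.trans j)

/-- Equivalence extensions: protoextensions that are equal, as sketch homomorphisms (hence on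
nodes and edges), to a finite composite of simple equivalence extensions. -/
def IsEquivExt (i : Hom T T') : Prop :=
  i.IsProtoExtension ∧ ∃ j : Hom T T', j.IsEquivExtComposite ∧ i.Agree j

end Hom

end Sketch

open Sketch

/-! ## The classifying arithmetic universe of a sketch

It is presented by the nodes and edges of the sketch as generators, and its implied relations: the
elements are the terms, built from the generators by the operators of the theory of arithmetic
universes, that are defined in every strict model, modulo equality in every strict model. -/

/-- The sorts of the theory of arithmetic universes. -/
inductive Srt
  | obj
  | arr

/-- The carriers of an arithmetic universe. -/
abbrev AUData.Carrier (A : AUData.{u}) : Srt → Type u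
  | .obj => A.Obj
  | .arr => A.Arr

/-- Formal terms in the generators given by a sketch. -/
inductive Tm (T : Sketch.{u}) : Srt → Type u
  | node : T.N → Tm T .obj
  | edge : T.E → Tm T .arr
  | dom : Tm T .arr → Tm T .obj
  | cod : Tm T .arr → Tm T .obj
  | id : Tm T .obj → Tm T .arr
  | comp : Tm T .arr → Tm T .arr → Tm T .arr
  | one : Tm T .obj
  | bang : Tm T .obj → Tm T .arr
  | pbFst : Tm T .arr → Tm T .arr → Tm T .arr
  | pbSnd : Tm T .arr → Tm T .arr → Tm T .arr
  | pair (u v a b : Tm T .arr) : Tm T .arr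
  | zero : Tm T .obj
  | cobang : Tm T .obj → Tm T .arr
  | poInl : Tm T .arr → Tm T .arr → Tm T .arr
  | poInr : Tm T .arr → Tm T .arr → Tm T .arr
  | copair (u v a b : Tm T .arr) : Tm T .arr
  | inv : Tm T .arr → Tm T .arr
  | nil : Tm T .obj → Tm T .arr
  | cons : Tm T .obj → Tm T .arr
  | lrec (n y cB α g a₁ a₂ m₁ m₂ : Tm T .arr) : Tm T .arr

namespace Tm

/-- `Ev M t x`: the term `t` is defined in the strict model `M`, with value `x`. -/
def Ev {T : Sketch.{u}} {A : AU.{v}} (M : StrictModel T A) :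
    {s : Srt} → Tm T s → A.Carrier s → Prop
  | _, .node X, x => M.node X = x
  | _, .edge f, x => M.edge f = x
  | _, .dom t, x => ∃ f, Ev M t f ∧ A.dom f = x
  | _, .cod t, x => ∃ f, Ev M t f ∧ A.cod f = x
  | _, .id t, x => ∃ X, Ev M t X ∧ A.id X = x
  | _, .comp s t, x => ∃ f g, Ev M s f ∧ Ev M t g ∧ A.Comm f g x
  | _, .one, x => A.one = x
  | _, .bang t, x => ∃ X, Ev M t X ∧ A.dom x = X ∧ A.cod x = A.one
  | _, .pbFst s t, x => ∃ f g y, Ev M s f ∧ Ev M t g ∧ A.Pb f g x y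
  | _, .pbSnd s t, x => ∃ f g y, Ev M s f ∧ Ev M t g ∧ A.Pb f g y x
  | _, .pair s t a b, x => ∃ f g k l, Ev M s f ∧ Ev M t g ∧ Ev M a k ∧ Ev M b l ∧
      ∃ p q d, A.Pb f g p q ∧ A.Comm k f d ∧ A.Comm l g d ∧ A.Comm x p k ∧ A.Comm x q l
  | _, .zero, x => A.zero = x
  | _, .cobang t, x => ∃ X, Ev M t X ∧ A.dom x = A.zero ∧ A.cod x = X
  | _, .poInl s t, x => ∃ f g y, Ev M s f ∧ Ev M t g ∧ A.Po f g x y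
  | _, .poInr s t, x => ∃ f g y, Ev M s f ∧ Ev M t g ∧ A.Po f g y x
  | _, .copair s t a b, x => ∃ f g k l, Ev M s f ∧ Ev M t g ∧ Ev M a k ∧ Ev M b l ∧
      ∃ i j d, A.Po f g i j ∧ A.Comm f k d ∧ A.Comm g l d ∧ A.Comm i x k ∧ A.Comm j x l
  | _, .inv t, x => ∃ f, Ev M t f ∧ A.Comm f x (A.id (A.dom f)) ∧ A.Comm x f (A.id (A.cod f))
  | _, .nil t, x => ∃ X, Ev M t X ∧ A.nil X = x
  | _, .cons t, x => ∃ X, Ev M t X ∧ A.cons X = x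
  | _, .lrec n y cB α g a₁ a₂ m₁ m₂, x => ∃ κ : A.toDiag.ListConfig,
      Ev M n κ.n ∧ Ev M y κ.y ∧ Ev M cB κ.cB ∧ Ev M α κ.α ∧ Ev M g κ.g ∧ Ev M a₁ κ.a₁ ∧
      Ev M a₂ κ.a₂ ∧ Ev M m₁ κ.m₁ ∧ Ev M m₂ κ.m₂ ∧ κ.IsRec x

end Tm

theorem AU.comm_inj {A : AU.{v}} {f g h h' : A.Arr} (H : A.Comm f g h) (H' : A.Comm f g h') :
    h = h' := by
  obtain ⟨_, rfl⟩ := H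
  obtain ⟨_, rfl⟩ := H'
  rfl

theorem AU.pb_inj {A : AU.{v}} {f g p q p' q' : A.Arr} (H : A.Pb f g p q) (H' : A.Pb f g p' q') :
    p = p' ∧ q = q' := by
  obtain ⟨_, rfl, rfl⟩ := H
  obtain ⟨_, rfl, rfl⟩ := H'
  exact ⟨rfl, rfl⟩

theorem AU.po_inj {A : AU.{v}} {f g p q p' q' : A.Arr} (H : A.Po f g p q) (H' : A.Po f g p' q') :
    p = p' ∧ q = q' := by
  obtain ⟨_, rfl, rfl⟩ := H
  obtain ⟨_, rfl, rfl⟩ := H'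
  exact ⟨rfl, rfl⟩

theorem AU.comm_dom {A : AU.{v}} {f g h : A.Arr} (H : A.Comm f g h) : A.dom h = A.dom f := by
  obtain ⟨_, rfl⟩ := H
  exact A.dom_comp _ _ _

theorem AU.comm_cod {A : AU.{v}} {f g h : A.Arr} (H : A.Comm f g h) : A.cod h = A.cod g := by
  obtain ⟨_, rfl⟩ := H
  exact A.cod_comp _ _ _

theorem AU.assoc' {A : AU.{v}} {f g h k l m : A.Arr} (h1 : A.Comm f g k) (h2 : A.Comm g h l)
    (h3 : A.Comm f l m) : A.Comm k h m := by
  have e : A.cod k = A.dom h := (AU.comm_cod h1).trans h2.1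
  have h4 := A.assoc h1 h2 ⟨e, rfl⟩
  exact ⟨e, AU.comm_inj h4 h3⟩

theorem AU.inv_inj {A : AU.{v}} {f g h : A.Arr} (h1 : A.Comm g f (A.id (A.cod f)))
    (h2 : A.Comm f h (A.id (A.dom f))) : g = h := by
  have e1 := A.cod_id (A.cod f) ▸ AU.comm_dom h1
  have e2 := AU.comm_cod h2
  rw [A.cod_id] at e2
  rw [A.dom_id] at e1
  have k1 := A.id_comp h
  have e3 : A.dom h = A.cod f := by obtain ⟨e, _⟩ := h2; exact e.symm
  rw [e3] at k1
  have k2 := A.assoc h1 h2 k1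
  have e4 : A.dom f = A.cod g := by obtain ⟨e, _⟩ := h1; exact e.symm
  rw [e4] at k2
  exact AU.comm_inj (A.comp_id g) k2

theorem Tm.Ev.unique {T : Sketch.{u}} {A : AU.{v}} {M : StrictModel T A} {s : Srt} {t : Tm T s}
    {x y : A.Carrier s} (hx : Ev M t x) (hy : Ev M t y) : x = y := by
  induction t with
  | node X => exact hx.symm.trans hy
  | edge X => exact hx.symm.trans hy
  | dom t ih =>
    obtain ⟨f, hf, rfl⟩ := hx
    obtain ⟨g, hg, rfl⟩ := hy
    rw [ih hf hg]
  | cod t ih =>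
    obtain ⟨f, hf, rfl⟩ := hx
    obtain ⟨g, hg, rfl⟩ := hy
    rw [ih hf hg]
  | id t ih =>
    obtain ⟨f, hf, rfl⟩ := hx
    obtain ⟨g, hg, rfl⟩ := hy
    rw [ih hf hg]
  | comp s t ihs iht =>
    obtain ⟨f, g, hf, hg, h⟩ := hx
    obtain ⟨f', g', hf', hg', h'⟩ := hy
    obtain rfl := ihs hf hf'
    obtain rfl := iht hg hg'
    exact AU.comm_inj h h'
  | one => exact hx.symm.trans hy
  | bang t ih =>
    obtain ⟨X, hX, h⟩ := hx
    obtain ⟨X', hX', h'⟩ := hy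
    obtain rfl := ih hX hX'
    exact (A.one_lift X).unique h h'
  | pbFst s t ihs iht =>
    obtain ⟨f, g, _, hf, hg, h⟩ := hx
    obtain ⟨f', g', _, hf', hg', h'⟩ := hy
    obtain rfl := ihs hf hf'
    obtain rfl := iht hg hg'
    exact (AU.pb_inj h h').1
  | pbSnd s t ihs iht =>
    obtain ⟨f, g, _, hf, hg, h⟩ := hx
    obtain ⟨f', g', _, hf', hg', h'⟩ := hy
    obtain rfl := ihs hf hf'
    obtain rfl := iht hg hg'
    exact (AU.pb_inj h h').2
  | pair s t a b ihs iht iha ihb =>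
    obtain ⟨f, g, k, l, hf, hg, hk, hl, p, q, d, h, h1, h2, h3, h4⟩ := hx
    obtain ⟨f', g', k', l', hf', hg', hk', hl', p', q', d', h', h1', h2', h3', h4'⟩ := hy
    obtain rfl := ihs hf hf'
    obtain rfl := iht hg hg'
    obtain rfl := iha hk hk'
    obtain rfl := ihb hl hl'
    obtain ⟨rfl, rfl⟩ := AU.pb_inj h h'
    exact (A.pb_lift h h1 h2).unique ⟨h3, h4⟩ ⟨h3', h4'⟩
  | zero => exact hx.symm.trans hy
  | cobang t ih =>
    obtain ⟨X, hX, h⟩ := hx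
    obtain ⟨X', hX', h'⟩ := hy
    obtain rfl := ih hX hX'
    exact (A.zero_desc X).unique h h'
  | poInl s t ihs iht =>
    obtain ⟨f, g, _, hf, hg, h⟩ := hx
    obtain ⟨f', g', _, hf', hg', h'⟩ := hy
    obtain rfl := ihs hf hf'
    obtain rfl := iht hg hg'
    exact (AU.po_inj h h').1
  | poInr s t ihs iht =>
    obtain ⟨f, g, _, hf, hg, h⟩ := hx
    obtain ⟨f', g', _, hf', hg', h'⟩ := hy
    obtain rfl := ihs hf hf'
    obtain rfl := iht hg hg'
    exact (AU.po_inj h h').2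
  | copair s t a b ihs iht iha ihb =>
    obtain ⟨f, g, k, l, hf, hg, hk, hl, p, q, d, h, h1, h2, h3, h4⟩ := hx
    obtain ⟨f', g', k', l', hf', hg', hk', hl', p', q', d', h', h1', h2', h3', h4'⟩ := hy
    obtain rfl := ihs hf hf'
    obtain rfl := iht hg hg'
    obtain rfl := iha hk hk'
    obtain rfl := ihb hl hl'
    obtain ⟨rfl, rfl⟩ := AU.po_inj h h'
    exact (A.po_desc h h1 h2).unique ⟨h3, h4⟩ ⟨h3', h4'⟩
  | inv t ih =>
    obtain ⟨f, hf, h1, h2⟩ := hx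
    obtain ⟨g, hg, h1', h2'⟩ := hy
    obtain rfl := ih hf hg
    exact AU.inv_inj h2 h1'
  | nil t ih =>
    obtain ⟨f, hf, rfl⟩ := hx
    obtain ⟨g, hg, rfl⟩ := hy
    rw [ih hf hg]
  | cons t ih =>
    obtain ⟨f, hf, rfl⟩ := hx
    obtain ⟨g, hg, rfl⟩ := hy
    rw [ih hf hg]
  | lrec n y cB α g a₁ a₂ m₁ m₂ i1 i2 i3 i4 i5 i6 i7 i8 i9 =>
    obtain ⟨κ, h1, h2, h3, h4, h5, h6, h7, h8, h9, hr⟩ := hx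
    obtain ⟨κ', h1', h2', h3', h4', h5', h6', h7', h8', h9', r', r'', g', g'', hr'⟩ := hy
    refine (A.list_rec κ).unique hr ⟨r', r'', g', g'', ?_⟩
    constructor
    · rw [i1 h1 h1', i2 h2 h2']; exact hr'.nil
    · rw [i3 h3 h3']; exact hr'.cons
    · rw [i4 h4 h4']; exact hr'.cons'
    · rw [i5 h5 h5']; exact hr'.step
    · rw [i7 h7 h7']; exact hr'.snd
    · rw [i8 h8 h8', i6 h6 h6']; exact hr'.fst'
    · rw [i9 h9 h9']; exact hr'.snd'

/-- The action of a homomorphism on the carriers. -/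
def AUData.Hom.carrier {A : AUData.{u}} {B : AUData.{v}} (F : AUData.Hom A B) :
    {s : Srt} → A.Carrier s → B.Carrier s
  | .obj, x => F.obj x
  | .arr, x => F.arr x

theorem Tm.Ev.map {T : Sketch.{u}} {A B : AU.{v}} {M : StrictModel T A} (F : A ⟶ B)
    {s : Srt} {t : Tm T s} {x : A.Carrier s} (hx : Ev M t x) :
    Ev (M.map F) t (AUData.Hom.carrier F x) := by
  induction t with
  | node X => exact congrArg F.obj hx
  | edge X => exact congrArg F.arr hx
  | dom t ih =>
    obtain ⟨f, hf, rfl⟩ := hx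
    exact ⟨_, ih hf, F.dom f⟩
  | cod t ih =>
    obtain ⟨f, hf, rfl⟩ := hx
    exact ⟨_, ih hf, F.cod f⟩
  | id t ih =>
    obtain ⟨f, hf, rfl⟩ := hx
    exact ⟨_, ih hf, (F.id f).symm⟩
  | comp s t ihs iht =>
    obtain ⟨f, g, hf, hg, h⟩ := hx
    exact ⟨_, _, ihs hf, iht hg, F.comm h⟩
  | one => exact F.one.symm.trans (congrArg F.obj hx)
  | bang t ih =>
    obtain ⟨X, hX, rfl, h⟩ := hx
    exact ⟨_, ih hX, F.dom _, (F.cod _).trans ((congrArg F.obj h).trans F.one)⟩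
  | pbFst s t ihs iht =>
    obtain ⟨f, g, _, hf, hg, h⟩ := hx
    exact ⟨_, _, _, ihs hf, iht hg, F.pb h⟩
  | pbSnd s t ihs iht =>
    obtain ⟨f, g, _, hf, hg, h⟩ := hx
    exact ⟨_, _, _, ihs hf, iht hg, F.pb h⟩
  | pair s t a b ihs iht iha ihb =>
    obtain ⟨f, g, k, l, hf, hg, hk, hl, p, q, d, h, h1, h2, h3, h4⟩ := hx
    exact ⟨_, _, _, _, ihs hf, iht hg, iha hk, ihb hl, _, _, _, F.pb h, F.comm h1, F.comm h2,
      F.comm h3, F.comm h4⟩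
  | zero => exact F.zero.symm.trans (congrArg F.obj hx)
  | cobang t ih =>
    obtain ⟨X, hX, h, rfl⟩ := hx
    exact ⟨_, ih hX, (F.dom _).trans ((congrArg F.obj h).trans F.zero), F.cod _⟩
  | poInl s t ihs iht =>
    obtain ⟨f, g, _, hf, hg, h⟩ := hx
    exact ⟨_, _, _, ihs hf, iht hg, F.po h⟩
  | poInr s t ihs iht =>
    obtain ⟨f, g, _, hf, hg, h⟩ := hx
    exact ⟨_, _, _, ihs hf, iht hg, F.po h⟩
  | copair s t a b ihs iht iha ihb =>
    obtain ⟨f, g, k, l, hf, hg, hk, hl, p, q, d, h, h1, h2, h3, h4⟩ := hx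
    exact ⟨_, _, _, _, ihs hf, iht hg, iha hk, ihb hl, _, _, _, F.po h, F.comm h1, F.comm h2,
      F.comm h3, F.comm h4⟩
  | inv t ih =>
    obtain ⟨f, hf, h1, h2⟩ := hx
    refine ⟨_, ih hf, ?_, ?_⟩
    · have := F.comm h1
      rw [F.id, ← F.dom] at this
      exact this
    · have := F.comm h2
      rw [F.id, ← F.cod] at this
      exact this
  | nil t ih =>
    obtain ⟨f, hf, rfl⟩ := hx
    exact ⟨_, ih hf, (F.nil f).symm⟩
  | cons t ih =>
    obtain ⟨f, hf, rfl⟩ := hx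
    exact ⟨_, ih hf, (F.cons f).symm⟩
  | lrec n y cB α g a₁ a₂ m₁ m₂ i1 i2 i3 i4 i5 i6 i7 i8 i9 =>
    obtain ⟨κ, h1, h2, h3, h4, h5, h6, h7, h8, h9, hr⟩ := hx
    exact ⟨(AUData.Hom.toDiagHom F).mapList κ, i1 h1, i2 h2, i3 h3, i4 h4, i5 h5, i6 h6, i7 h7,
      i8 h8, i9 h9, (AUData.Hom.toDiagHom F).isRec hr⟩

namespace Pres

/-- The term `t` is defined in every strict model. -/
def Defined {T : Sketch.{u}} {s : Srt} (t : Tm T s) : Prop :=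
  ∀ (A : AU.{u}) (M : StrictModel T A), ∃ x, t.Ev M x

/-- Equality of terms in every strict model. -/
instance setoid (T : Sketch.{u}) (s : Srt) : Setoid {t : Tm T s // Defined t} where
  r t t' := ∀ (A : AU.{u}) (M : StrictModel T A) (x : A.Carrier s), t.1.Ev M x ↔ t'.1.Ev M x
  iseqv := ⟨fun _ _ _ _ => Iff.rfl, fun h A M x => (h A M x).symm,
    fun h h' A M x => (h A M x).trans (h' A M x)⟩

/-- Elements of the presented arithmetic universe. -/
def El (T : Sketch.{u}) (s : Srt) : Type u := Quotient (setoid T s)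

section

variable {T : Sketch.{u}} {A : AU.{v}} {M : StrictModel T A}

theorem ev_node {X : T.N} : (Tm.node X : Tm T .obj).Ev M (M.node X) := rfl

theorem ev_edge {f : T.E} : (Tm.edge f : Tm T .arr).Ev M (M.edge f) := rfl

theorem ev_dom {t : Tm T .arr} {f : A.Arr} (h : t.Ev M f) : (Tm.dom t).Ev M (A.dom f) :=
  ⟨f, h, rfl⟩

theorem ev_cod {t : Tm T .arr} {f : A.Arr} (h : t.Ev M f) : (Tm.cod t).Ev M (A.cod f) :=
  ⟨f, h, rfl⟩

theorem ev_id {t : Tm T .obj} {X : A.Obj} (h : t.Ev M X) : (Tm.id t).Ev M (A.id X) :=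
  ⟨X, h, rfl⟩

theorem ev_nil {t : Tm T .obj} {X : A.Obj} (h : t.Ev M X) : (Tm.nil t).Ev M (A.nil X) :=
  ⟨X, h, rfl⟩

theorem ev_cons {t : Tm T .obj} {X : A.Obj} (h : t.Ev M X) : (Tm.cons t).Ev M (A.cons X) :=
  ⟨X, h, rfl⟩

theorem ev_one : (Tm.one : Tm T .obj).Ev M A.one := rfl

theorem ev_zero : (Tm.zero : Tm T .obj).Ev M A.zero := rfl

theorem ev_comp {t t' : Tm T .arr} {f g : A.Arr} (h : t.Ev M f) (h' : t'.Ev M g)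
    (e : A.cod f = A.dom g) : (Tm.comp t t').Ev M (A.comp f g e) :=
  ⟨f, g, h, h', e, rfl⟩

theorem ev_pbFst {t t' : Tm T .arr} {f g : A.Arr} (h : t.Ev M f) (h' : t'.Ev M g)
    (e : A.cod f = A.cod g) : (Tm.pbFst t t').Ev M (A.pbFst f g e) :=
  ⟨f, g, _, h, h', e, rfl, rfl⟩

theorem ev_pbSnd {t t' : Tm T .arr} {f g : A.Arr} (h : t.Ev M f) (h' : t'.Ev M g)
    (e : A.cod f = A.cod g) : (Tm.pbSnd t t').Ev M (A.pbSnd f g e) :=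
  ⟨f, g, _, h, h', e, rfl, rfl⟩

theorem ev_poInl {t t' : Tm T .arr} {f g : A.Arr} (h : t.Ev M f) (h' : t'.Ev M g)
    (e : A.dom f = A.dom g) : (Tm.poInl t t').Ev M (A.poInl f g e) :=
  ⟨f, g, _, h, h', e, rfl, rfl⟩

theorem ev_poInr {t t' : Tm T .arr} {f g : A.Arr} (h : t.Ev M f) (h' : t'.Ev M g)
    (e : A.dom f = A.dom g) : (Tm.poInr t t').Ev M (A.poInr f g e) :=
  ⟨f, g, _, h, h', e, rfl, rfl⟩

end

noncomputable section

variable {T : Sketch.{u}} {s : Srt}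

/-- A representing term. -/
def rep (x : El T s) : Tm T s := (Quotient.out x).1

/-- The value of an element in a strict model. -/
def val {A : AU.{u}} (M : StrictModel T A) (x : El T s) : A.Carrier s :=
  Classical.choose ((Quotient.out x).2 A M)

theorem ev_rep {A : AU.{u}} (M : StrictModel T A) (x : El T s) : (rep x).Ev M (val M x) :=
  Classical.choose_spec ((Quotient.out x).2 A M)

theorem ext {x y : El T s}
    (h : ∀ (A : AU.{u}) (M : StrictModel T A), val M x = val M y) : x = y := by
  rw [← Quotient.out_eq x, ← Quotient.out_eq y]
  refine Quotient.sound fun A M z => ⟨fun hz => ?_, fun hz => ?_⟩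
  · rw [(show z = val M y from (hz.unique (ev_rep M x)).trans (h A M))]
    exact ev_rep M y
  · rw [(show z = val M x from (hz.unique (ev_rep M y)).trans (h A M).symm)]
    exact ev_rep M x

/-- The element given by a term and its values in all strict models. -/
def mk (t : Tm T s) (f : ∀ (A : AU.{u}) (_ : StrictModel T A), A.Carrier s)
    (h : ∀ (A : AU.{u}) (M : StrictModel T A), t.Ev M (f A M)) : El T s :=
  Quotient.mk _ ⟨t, fun A M => ⟨f A M, h A M⟩⟩

theorem val_mk {t : Tm T s} {f : ∀ (A : AU.{u}) (_ : StrictModel T A), A.Carrier s}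
    {h : ∀ (A : AU.{u}) (M : StrictModel T A), t.Ev M (f A M)}
    {A : AU.{u}} (M : StrictModel T A) : val M (mk t f h) = f A M := by
  have h1 := ev_rep M (mk t f h)
  have h2 := (Quotient.exact (Quotient.out_eq (mk t f h)) A M _).1 h1
  exact h2.unique (h A M)

attribute [irreducible] mk

/-- Domain. -/
def dom (x : El T .arr) : El T .obj :=
  mk (.dom (rep x)) (fun A M => A.dom (val M x)) fun _ M => ev_dom (ev_rep M x)

/-- Codomain. -/
def cod (x : El T .arr) : El T .obj :=
  mk (.cod (rep x)) (fun A M => A.cod (val M x)) fun _ M => ev_cod (ev_rep M x)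

theorem val_dom {A : AU.{u}} (M : StrictModel T A) (f : El T .arr) :
    val M (dom f) = A.dom (val M f) := by rw [dom, val_mk]

theorem val_cod {A : AU.{u}} (M : StrictModel T A) (f : El T .arr) :
    val M (cod f) = A.cod (val M f) := by rw [cod, val_mk]

theorem cod_dom {f g : El T .arr} (e : cod f = dom g) {A : AU.{u}} (M : StrictModel T A) :
    A.cod (val M f) = A.dom (val M g) := by
  have := congrArg (val M) e
  rwa [cod, dom, val_mk, val_mk] at this

theorem cod_cod {f g : El T .arr} (e : cod f = cod g) {A : AU.{u}} (M : StrictModel T A) :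
    A.cod (val M f) = A.cod (val M g) := by
  have := congrArg (val M) e
  rwa [cod, cod, val_mk, val_mk] at this

theorem dom_dom {f g : El T .arr} (e : dom f = dom g) {A : AU.{u}} (M : StrictModel T A) :
    A.dom (val M f) = A.dom (val M g) := by
  have := congrArg (val M) e
  rwa [dom, dom, val_mk, val_mk] at this

variable (T) in
/-- The operators on the presented arithmetic universe. -/
def data : AUData.{u} where
  Obj := El T .obj
  Arr := El T .arr
  dom := dom
  cod := cod
  id X := mk (.id (rep X)) (fun A M => A.id (val M X)) fun _ M => ev_id (ev_rep M X)
  comp f g e := mk (.comp (rep f) (rep g))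
    (fun A M => A.comp (val M f) (val M g) (cod_dom e M))
    fun _ M => ev_comp (ev_rep M f) (ev_rep M g) _
  one := mk .one (fun A _ => A.one) fun _ _ => ev_one
  pbFst f g e := mk (.pbFst (rep f) (rep g))
    (fun A M => A.pbFst (val M f) (val M g) (cod_cod e M))
    fun _ M => ev_pbFst (ev_rep M f) (ev_rep M g) _
  pbSnd f g e := mk (.pbSnd (rep f) (rep g))
    (fun A M => A.pbSnd (val M f) (val M g) (cod_cod e M))
    fun _ M => ev_pbSnd (ev_rep M f) (ev_rep M g) _
  zero := mk .zero (fun A _ => A.zero) fun _ _ => ev_zero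
  poInl f g e := mk (.poInl (rep f) (rep g))
    (fun A M => A.poInl (val M f) (val M g) (dom_dom e M))
    fun _ M => ev_poInl (ev_rep M f) (ev_rep M g) _
  poInr f g e := mk (.poInr (rep f) (rep g))
    (fun A M => A.poInr (val M f) (val M g) (dom_dom e M))
    fun _ M => ev_poInr (ev_rep M f) (ev_rep M g) _
  nil X := mk (.nil (rep X)) (fun A M => A.nil (val M X)) fun _ M => ev_nil (ev_rep M X)
  cons X := mk (.cons (rep X)) (fun A M => A.cons (val M X)) fun _ M => ev_cons (ev_rep M X)

/-- Evaluation in a strict model is a homomorphism. -/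
def valHom {A : AU.{u}} (M : StrictModel T A) : AUData.Hom (data T) A.toAUData where
  obj X := val (s := .obj) M X
  arr f := val (s := .arr) M f
  dom f := (val_dom M f).symm
  cod f := (val_cod M f).symm
  id _ := val_mk (s := .arr) M
  comp _ _ _ _ := val_mk (s := .arr) M
  one := val_mk (s := .obj) M
  pbFst _ _ _ _ := val_mk (s := .arr) M
  pbSnd _ _ _ _ := val_mk (s := .arr) M
  zero := val_mk (s := .obj) M
  poInl _ _ _ _ := val_mk (s := .arr) M
  poInr _ _ _ _ := val_mk (s := .arr) M
  nil _ := val_mk (s := .arr) M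
  cons _ := val_mk (s := .arr) M

theorem ext_obj {x y : (data T).Obj}
    (h : ∀ (A : AU.{u}) (M : StrictModel T A), (valHom M).obj x = (valHom M).obj y) : x = y :=
  ext h

theorem ext_arr {x y : (data T).Arr}
    (h : ∀ (A : AU.{u}) (M : StrictModel T A), (valHom M).arr x = (valHom M).arr y) : x = y :=
  ext h

theorem comm_of {f g k : (data T).Arr} (h : ∀ (A : AU.{u}) (M : StrictModel T A),
    A.Comm ((valHom M).arr f) ((valHom M).arr g) ((valHom M).arr k)) : (data T).Comm f g k := by
  have e : (data T).cod f = (data T).dom g := ext_obj fun A M => by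
    rw [← (valHom M).cod, ← (valHom M).dom]; exact (h A M).1
  refine ⟨e, ext_arr fun A M => ?_⟩
  rw [(valHom M).comp _ _ _ (h A M).1]
  exact (h A M).2

theorem exists_arr (t : Tm T .arr) (P : ∀ (A : AU.{u}) (_ : StrictModel T A), A.Arr → Prop)
    (ht : ∀ (A : AU.{u}) (M : StrictModel T A) (x : A.Arr), P A M x → t.Ev M x)
    (h : ∀ (A : AU.{u}) (M : StrictModel T A), ∃ x, P A M x) :
    ∃ x : (data T).Arr, ∀ (A : AU.{u}) (M : StrictModel T A), P A M ((valHom M).arr x) := by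
  refine ⟨mk t (fun A M => (h A M).choose) fun A M => ht A M _ (h A M).choose_spec,
    fun A M => ?_⟩
  have : (valHom M).arr (mk t (fun A M => (h A M).choose)
    fun A M => ht A M _ (h A M).choose_spec) = (h A M).choose := val_mk (s := .arr) M
  rw [this]
  exact (h A M).choose_spec

theorem pb_of {f g p q : (data T).Arr} (h : ∀ (A : AU.{u}) (M : StrictModel T A),
    A.Pb ((valHom M).arr f) ((valHom M).arr g) ((valHom M).arr p) ((valHom M).arr q)) :
    (data T).Pb f g p q := by
  have e : (data T).cod f = (data T).cod g := ext_obj fun A M => by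
    rw [← (valHom M).cod, ← (valHom M).cod]; exact (h A M).1
  refine ⟨e, ext_arr fun A M => ?_, ext_arr fun A M => ?_⟩
  · rw [(valHom M).pbFst _ _ _ (h A M).1]
    exact (h A M).2.1
  · rw [(valHom M).pbSnd _ _ _ (h A M).1]
    exact (h A M).2.2

theorem po_of {f g p q : (data T).Arr} (h : ∀ (A : AU.{u}) (M : StrictModel T A),
    A.Po ((valHom M).arr f) ((valHom M).arr g) ((valHom M).arr p) ((valHom M).arr q)) :
    (data T).Po f g p q := by
  have e : (data T).dom f = (data T).dom g := ext_obj fun A M => by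
    rw [← (valHom M).dom, ← (valHom M).dom]; exact (h A M).1
  refine ⟨e, ext_arr fun A M => ?_, ext_arr fun A M => ?_⟩
  · rw [(valHom M).poInl _ _ _ (h A M).1]
    exact (h A M).2.1
  · rw [(valHom M).poInr _ _ _ (h A M).1]
    exact (h A M).2.2

/-- The generator given by a node. -/
def node (X : T.N) : (data T).Obj :=
  mk (s := .obj) (.node X) (fun _ M => M.node X) fun _ _ => ev_node

/-- The generator given by an edge. -/
def edge (f : T.E) : (data T).Arr :=
  mk (s := .arr) (.edge f) (fun _ M => M.edge f) fun _ _ => ev_edge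

theorem val_node {A : AU.{u}} (M : StrictModel T A) (X : T.N) :
    (valHom M).obj (node X) = M.node X := val_mk (s := .obj) M

theorem val_edge {A : AU.{u}} (M : StrictModel T A) (f : T.E) :
    (valHom M).arr (edge f) = M.edge f := val_mk (s := .arr) M

theorem invertible_of {f : (data T).Arr} (h : ∀ (A : AU.{u}) (M : StrictModel T A),
    A.toDiag.Invertible ((valHom M).arr f)) : (data T).toDiag.Invertible f := by
  obtain ⟨g, hg⟩ := exists_arr (.inv (rep f)) (fun A M x =>
    A.Comm ((valHom M).arr f) x (A.id (A.dom ((valHom M).arr f))) ∧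
    A.Comm x ((valHom M).arr f) (A.id (A.cod ((valHom M).arr f))))
    (fun A M x hx => ⟨_, ev_rep M f, hx⟩) h
  refine ⟨g, comm_of fun A M => ?_, comm_of fun A M => ?_⟩
  · have := (hg A M).1
    rw [(valHom M).dom, ← (valHom M).id] at this
    exact this
  · have := (hg A M).2
    rw [(valHom M).cod, ← (valHom M).id] at this
    exact this

end

end Pres

open Pres in
/-- The classifying arithmetic universe `AU⟨T⟩` of a sketch `T`. -/
noncomputable def AUPres (T : Sketch.{u}) : AU.{u} where
  toAUData := data T
  dom_id X := ext_obj fun A M => by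
    rw [← (valHom M).dom, (valHom M).id, A.dom_id]
  cod_id X := ext_obj fun A M => by
    rw [← (valHom M).cod, (valHom M).id, A.cod_id]
  dom_comp f g h := ext_obj fun A M => by
    rw [← (valHom M).dom, ← (valHom M).dom, (valHom M).comp _ _ h (by rw [(valHom M).cod, (valHom M).dom, h]), A.dom_comp]
  cod_comp f g h := ext_obj fun A M => by
    rw [← (valHom M).cod, ← (valHom M).cod, (valHom M).comp _ _ h (by rw [(valHom M).cod, (valHom M).dom, h]), A.cod_comp]
  id_comp f := comm_of fun A M => by
    rw [(valHom M).id, ← (valHom M).dom]; exact A.id_comp _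
  comp_id f := comm_of fun A M => by
    rw [(valHom M).id, ← (valHom M).cod]; exact A.comp_id _
  assoc h1 h2 h3 := comm_of fun A M =>
    A.assoc ((valHom M).comm h1) ((valHom M).comm h2) ((valHom M).comm h3)
  one_lift X := by
    obtain ⟨f, hf⟩ := exists_arr (.bang (rep X)) (fun A M x =>
      A.dom x = (valHom M).obj X ∧ A.cod x = A.one)
      (fun A M x hx => ⟨_, ev_rep M X, hx⟩) fun A M => (A.one_lift _).exists
    refine ⟨f, ⟨ext_obj fun A M => ?_, ext_obj fun A M => ?_⟩, fun g hg => ext_arr fun A M => ?_⟩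
    · rw [← (valHom M).dom, (hf A M).1]
    · rw [← (valHom M).cod, (hf A M).2, (valHom M).one]
    · refine (A.one_lift _).unique ⟨?_, ?_⟩ (hf A M)
      · rw [(valHom M).dom, hg.1]
      · rw [(valHom M).cod, hg.2, (valHom M).one]
  pb_cone {f g p q} h := by
    obtain ⟨d, hd⟩ := exists_arr (.comp (rep p) (rep f)) (fun A M x =>
      A.Comm ((valHom M).arr p) ((valHom M).arr f) x ∧
      A.Comm ((valHom M).arr q) ((valHom M).arr g) x)
      (fun A M x hx => ⟨_, _, ev_rep M p, ev_rep M f, hx.1⟩)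
      fun A M => A.pb_cone ((valHom M).pb h)
    exact ⟨d, comm_of fun A M => (hd A M).1, comm_of fun A M => (hd A M).2⟩
  pb_lift {f g p q a b d} h h1 h2 := by
    obtain ⟨k, hk⟩ := exists_arr (.pair (rep f) (rep g) (rep a) (rep b)) (fun A M x =>
      A.Comm x ((valHom M).arr p) ((valHom M).arr a) ∧
      A.Comm x ((valHom M).arr q) ((valHom M).arr b))
      (fun A M x hx => ⟨_, _, _, _, ev_rep M f, ev_rep M g, ev_rep M a, ev_rep M b, _, _, _,
        (valHom M).pb h, (valHom M).comm h1, (valHom M).comm h2, hx.1, hx.2⟩)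
      fun A M => (A.pb_lift ((valHom M).pb h) ((valHom M).comm h1) ((valHom M).comm h2)).exists
    exact ⟨k, ⟨comm_of fun A M => (hk A M).1, comm_of fun A M => (hk A M).2⟩,
      fun k' hk' => ext_arr fun A M =>
        (A.pb_lift ((valHom M).pb h) ((valHom M).comm h1) ((valHom M).comm h2)).unique
        ⟨(valHom M).comm hk'.1, (valHom M).comm hk'.2⟩ (hk A M)⟩
  zero_desc X := by
    obtain ⟨f, hf⟩ := exists_arr (.cobang (rep X)) (fun A M x =>
      A.dom x = A.zero ∧ A.cod x = (valHom M).obj X)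
      (fun A M x hx => ⟨_, ev_rep M X, hx⟩) fun A M => (A.zero_desc _).exists
    refine ⟨f, ⟨ext_obj fun A M => ?_, ext_obj fun A M => ?_⟩, fun g hg => ext_arr fun A M => ?_⟩
    · rw [← (valHom M).dom, (hf A M).1, (valHom M).zero]
    · rw [← (valHom M).cod, (hf A M).2]
    · refine (A.zero_desc _).unique ⟨?_, ?_⟩ (hf A M)
      · rw [(valHom M).dom, hg.1, (valHom M).zero]
      · rw [(valHom M).cod, hg.2]
  po_cocone {f g p q} h := by
    obtain ⟨d, hd⟩ := exists_arr (.comp (rep f) (rep p)) (fun A M x =>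
      A.Comm ((valHom M).arr f) ((valHom M).arr p) x ∧
      A.Comm ((valHom M).arr g) ((valHom M).arr q) x)
      (fun A M x hx => ⟨_, _, ev_rep M f, ev_rep M p, hx.1⟩)
      fun A M => A.po_cocone ((valHom M).po h)
    exact ⟨d, comm_of fun A M => (hd A M).1, comm_of fun A M => (hd A M).2⟩
  po_desc {f g p q a b d} h h1 h2 := by
    obtain ⟨k, hk⟩ := exists_arr (.copair (rep f) (rep g) (rep a) (rep b)) (fun A M x =>
      A.Comm ((valHom M).arr p) x ((valHom M).arr a) ∧
      A.Comm ((valHom M).arr q) x ((valHom M).arr b))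
      (fun A M x hx => ⟨_, _, _, _, ev_rep M f, ev_rep M g, ev_rep M a, ev_rep M b, _, _, _,
        (valHom M).po h, (valHom M).comm h1, (valHom M).comm h2, hx.1, hx.2⟩)
      fun A M => (A.po_desc ((valHom M).po h) ((valHom M).comm h1) ((valHom M).comm h2)).exists
    exact ⟨k, ⟨comm_of fun A M => (hk A M).1, comm_of fun A M => (hk A M).2⟩,
      fun k' hk' => ext_arr fun A M =>
        (A.po_desc ((valHom M).po h) ((valHom M).comm h1) ((valHom M).comm h2)).unique
        ⟨(valHom M).comm hk'.1, (valHom M).comm hk'.2⟩ (hk A M)⟩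
  zero_stable f hf := invertible_of fun A M => A.zero_stable _ (by
    rw [(valHom M).cod, hf, (valHom M).zero])
  po_stable κ := invertible_of fun A M => A.po_stable ((valHom M).toDiagHom.mapPushoutStab κ)
  balance κ := invertible_of fun A M => A.balance ((valHom M).toDiagHom.mapBalance κ)
  exact κ := invertible_of fun A M => A.exact ((valHom M).toDiagHom.mapExact κ)
  dom_nil X := ext_obj fun A M => by
    rw [← (valHom M).dom, (valHom M).nil, A.dom_nil, (valHom M).one]
  cod_cons X := ext_obj fun A M => by
    rw [← (valHom M).cod, (valHom M).cons, A.cod_cons, (valHom M).obj_list]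
  dom_cons X p q h := ext_obj fun A M => by
    have h1 := (valHom M).toDiagHom.isProd h
    have h2 : A.toDiag.IsProd ((valHom M).obj X) (A.list ((valHom M).obj X))
        ((valHom M).arr p) ((valHom M).arr q) := by
      rw [← (valHom M).obj_list]
      exact h1
    have h3 := (valHom M).cons X
    have h4 := (valHom M).dom p
    refine ((valHom M).dom _).symm.trans ?_
    rw [h3]
    exact (A.dom_cons _ _ _ h2).trans h4
  list_rec κ := by
    obtain ⟨r, hr⟩ := exists_arr (.lrec (rep κ.n) (rep κ.y) (rep κ.cB) (rep κ.α) (rep κ.g)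
      (rep κ.a₁) (rep κ.a₂) (rep κ.m₁) (rep κ.m₂))
      (fun A M x => ((valHom M).toDiagHom.mapList κ).IsRec x)
      (fun A M x hx => ⟨(valHom M).toDiagHom.mapList κ, ev_rep M κ.n, ev_rep M κ.y,
        ev_rep M κ.cB, ev_rep M κ.α, ev_rep M κ.g, ev_rep M κ.a₁, ev_rep M κ.a₂,
        ev_rep M κ.m₁, ev_rep M κ.m₂, hx⟩)
      fun A M => (A.list_rec _).exists
    refine ⟨r, ?_, fun r' hr' => ext_arr fun A M =>
      (A.list_rec _).unique ((valHom M).toDiagHom.isRec hr') (hr A M)⟩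
    obtain ⟨u, v, -, -, -, huv⟩ := κ.prodAY
    obtain ⟨r', hr'⟩ := exists_arr
      (.pair (rep u) (rep v) (rep κ.a₁) (.comp (rep κ.a₂) (rep r)))
      (fun A M x => ∃ r'' g' g'',
        ((valHom M).toDiagHom.mapList κ).IsSolution ((valHom M).arr r) x r'' g' g'')
      (fun A M x hx => by
        obtain ⟨r'', g', g'', hx⟩ := hx
        have h := (valHom M).pb huv
        obtain ⟨d, hd1, hd2⟩ := A.pb_cone h
        have e : A.cod x = A.dom d := by
          rw [AU.comm_dom hd1]; exact hx.fst'.1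
        exact ⟨_, _, _, r'', ev_rep M u, ev_rep M v, ev_rep M κ.a₁,
          ⟨_, _, ev_rep M κ.a₂, ev_rep M r, hx.snd⟩, _, _, A.comp x d e, h,
          AU.assoc' hx.fst' hd1 ⟨e, rfl⟩, AU.assoc' hx.snd' hd2 ⟨e, rfl⟩, hx.fst', hx.snd'⟩)
      hr
    obtain ⟨r'', hr''⟩ := exists_arr (.comp (rep κ.a₂) (rep r))
      (fun A M x => ∃ g' g'', ((valHom M).toDiagHom.mapList κ).IsSolution ((valHom M).arr r)
        ((valHom M).arr r') x g' g'')
      (fun A M x hx => by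
        obtain ⟨g', g'', hx⟩ := hx
        exact ⟨_, _, ev_rep M κ.a₂, ev_rep M r, hx.snd⟩) hr'
    obtain ⟨g', hg'⟩ := exists_arr (.comp (rep r') (rep κ.g))
      (fun A M x => ∃ g'', ((valHom M).toDiagHom.mapList κ).IsSolution ((valHom M).arr r)
        ((valHom M).arr r') ((valHom M).arr r'') x g'')
      (fun A M x hx => by
        obtain ⟨g'', hx⟩ := hx
        exact ⟨_, _, ev_rep M r', ev_rep M κ.g, hx.step⟩) hr''
    obtain ⟨g'', hg''⟩ := exists_arr (.comp (rep κ.cB) (rep r))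
      (fun A M x => ((valHom M).toDiagHom.mapList κ).IsSolution ((valHom M).arr r)
        ((valHom M).arr r') ((valHom M).arr r'') ((valHom M).arr g') x)
      (fun A M x hx => ⟨_, _, ev_rep M κ.cB, ev_rep M r, hx.cons⟩) hg'
    exact ⟨r', r'', g', g'', comm_of fun A M => (hg'' A M).nil,
      comm_of fun A M => (hg'' A M).cons, comm_of fun A M => (hg'' A M).cons',
      comm_of fun A M => (hg'' A M).step, comm_of fun A M => (hg'' A M).snd,
      comm_of fun A M => (hg'' A M).fst', comm_of fun A M => (hg'' A M).snd'⟩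

namespace AUPres

open Pres

/-- The generic strict model of `T` in `AU⟨T⟩`. -/
noncomputable def generic (T : Sketch.{u}) : StrictModel T (AUPres T) where
  node := node
  edge := edge
  dom f := ext_obj fun A M =>
    ((valHom M).dom _).symm.trans (by rw [val_node, val_edge, M.dom])
  cod f := ext_obj fun A M =>
    ((valHom M).cod _).symm.trans (by rw [val_node, val_edge, M.cod])
  id X := ext_arr fun A M =>
    ((valHom M).id _).trans (by rw [val_node, val_edge, M.id])
  tri τ := comm_of fun A M => by
    rw [val_edge, val_edge, val_edge]; exact M.tri τ
  one ω := ext_obj fun A M => by rw [val_node, M.one]; exact (valHom M).one.symm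
  zero ω := ext_obj fun A M => by rw [val_node, M.zero]; exact (valHom M).zero.symm
  pb ω := pb_of fun A M => by
    rw [val_edge, val_edge, val_edge, val_edge]; exact M.pb ω
  po ω := po_of fun A M => by
    rw [val_edge, val_edge, val_edge, val_edge]; exact M.po ω
  nil ω := ext_arr fun A M =>
    ((valHom M).nil _).trans (by rw [val_node, val_edge, M.nil])
  cons ω := ext_arr fun A M =>
    ((valHom M).cons _).trans (by rw [val_node, val_edge, M.cons])

/-- The strict AU-functor out of `AU⟨T⟩` that corresponds to a strict model of `T`. -/
noncomputable def lift {T : Sketch.{u}} {A : AU.{u}} (M : StrictModel T A) : AUPres T ⟶ A :=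
  valHom M

theorem generic_map_lift {T : Sketch.{u}} {A : AU.{u}} (M : StrictModel T A) :
    (generic T).map (lift M) = M :=
  StrictModel.ext (funext fun X => val_node M X) (funext fun f => val_edge M f)

/-- The universal property of `AU⟨T⟩`: a strict model of `T` in `A` extends uniquely to a strict
AU-functor from `AU⟨T⟩` to `A`. -/
theorem existsUnique_lift {T : Sketch.{u}} {A : AU.{u}} (M : StrictModel T A) :
    ∃! F : AUPres T ⟶ A, (generic T).map F = M := by
  refine ⟨lift M, generic_map_lift M, fun F hF => ?_⟩
  have key : ∀ {s : Srt} (x : (AUPres T).Carrier s) (t : Tm T s), t.Ev (generic T) x →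
      AUData.Hom.carrier F x = AUData.Hom.carrier (lift M) x := fun x t ht => by
    have h1 := ht.map F
    have h2 := ht.map (lift M)
    rw [hF] at h1
    rw [generic_map_lift] at h2
    exact h1.unique h2
  have ho : ∀ x : El T .obj, (rep x).Ev (generic T) x := fun x => by
    have h := ev_rep (generic T) x
    have e : val (generic T) x = x := ext fun A N => by
      have h' := h.map (lift N)
      rw [generic_map_lift] at h'
      exact h'.unique (ev_rep N x)
    rwa [e] at h
  have ha : ∀ x : El T .arr, (rep x).Ev (generic T) x := fun x => by
    have h := ev_rep (generic T) x
    have e : val (generic T) x = x := ext fun A N => by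
      have h' := h.map (lift N)
      rw [generic_map_lift] at h'
      exact h'.unique (ev_rep N x)
    rwa [e] at h
  exact AUData.Hom.ext (funext fun x => key (s := .obj) x _ (ho x))
    (funext fun x => key (s := .arr) x _ (ha x))

/-- The strict AU-functor `AU⟨e⟩ : AU⟨T⟩ ⟶ AU⟨T'⟩` given by a sketch homomorphism `e`: it
corresponds to the reduct along `e` of the generic model of `T'`. -/
noncomputable def map {T T' : Sketch.{u}} (e : Sketch.Hom T T') : AUPres T ⟶ AUPres T' :=
  lift ((generic T').reduct e)

end AUPres

end ArithUniv

/-! A strict model is determined by its values on nodes and edges; commutativities and universals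
are conditions on these values, stated with equality. To extend a model along a protoextension
therefore means to choose values for the finitely many fresh nodes and edges so that the fresh
conditions hold. `Adjoins.existsUnique` turns this into a finite check: a list of proposed values
must satisfy the conditions carried by the delta, and every extension must take those values.

For each simple equivalence extension the check succeeds because the fresh data are forced. A fresh
universal must be the canonically chosen structure, since strictness leaves no freedom up to
isomorphism. A fillin exists and is unique by the universal property, and an inverse is unique if it
exists. The axioms of stability, balance and exactness supply the inverses. A fresh commutativity
adds nothing to choose and already holds, by the category axioms or by uniqueness of fillins. Unique
extension passes to finite composites by induction, and from a composite to any homomorphism that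
agrees with it on nodes and edges, because reducts read nothing else.

The statement on presented arithmetic universes is then a Yoneda argument (`isIso_map`). Strict
functors out of `AUPres T` are strict models of `T`, and precomposition with `AUPres.map e` is
reduct along `e`. The inverse functor corresponds to the unique extension to `T'` of the generic
model of `T`, and uniqueness of extensions in `AUPres T'` shows that it is two-sided. -/

namespace ArithUniv

open Sketch

/-! ### Cancellation in an arithmetic universe -/

namespace AU

variable {A : AU.{v}}

theorem eqv_of_eq {f g : A.Arr} (h : f = g) : A.Comm (A.id (A.dom f)) f g :=
  h ▸ A.id_comp f

/-- Projections of a pullback are jointly monic. `pb_lift` asks for a commuting cone on `a`, `b`;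
composing `k` with the diagonal `d` of the pullback square shows that they form one. -/
theorem pb_hom_ext {f g p q k k' a b : A.Arr} (h : A.Pb f g p q) (h₁ : A.Comm k p a)
    (h₂ : A.Comm k q b) (h₁' : A.Comm k' p a) (h₂' : A.Comm k' q b) : k = k' := by
  obtain ⟨d, hp, hq⟩ := A.pb_cone h
  have e : A.cod k = A.dom d := h₁.1.trans (comm_dom hp).symm
  exact (A.pb_lift h (assoc' h₁ hp ⟨e, rfl⟩) (assoc' h₂ hq ⟨e, rfl⟩)).unique ⟨h₁, h₂⟩ ⟨h₁', h₂'⟩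

theorem po_hom_ext {f g i j k k' a b : A.Arr} (h : A.Po f g i j) (h₁ : A.Comm i k a)
    (h₂ : A.Comm j k b) (h₁' : A.Comm i k' a) (h₂' : A.Comm j k' b) : k = k' := by
  obtain ⟨d, hi, hj⟩ := A.po_cocone h
  have e : A.cod d = A.dom k := (comm_cod hi).trans h₁.1
  exact (A.po_desc h (A.assoc hi h₁ ⟨e, rfl⟩) (A.assoc hj h₂ ⟨e, rfl⟩)).unique ⟨h₁, h₂⟩ ⟨h₁', h₂'⟩

end AU

/-! ### Strict models as interpretations of nodes and edges -/

namespace Sketch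

namespace StrictModel

variable {T T' : Sketch.{u}} {A : AU.{v}}

/-- A strict model preserves the marked diagrams. -/
abbrev toDiagHom (M : StrictModel T A) : Diag.Hom T.toDiag A.toDiag where
  node := M.node
  edge := M.edge
  dom := M.dom
  cod := M.cod
  id := M.id
  comm := by rintro _ _ _ ⟨τ, rfl, rfl, rfl⟩; exact M.tri τ
  one := by rintro _ ⟨ω, rfl⟩; exact M.one ω
  zero := by rintro _ ⟨ω, rfl⟩; exact M.zero ω
  pb := by rintro _ _ _ _ ⟨ω, rfl, rfl, rfl, rfl⟩; exact M.pb ω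
  po := by rintro _ _ _ _ ⟨ω, rfl, rfl, rfl, rfl⟩; exact M.po ω
  lst := by
    rintro _ _ _ _ ⟨ω, rfl, rfl, rfl, rfl⟩
    -- The product required by `AUData.Lst` is the pullback universal of `ω`; its legs are the edges
    -- from the base and from the list node to the terminal node.
    refine ⟨M.node (T.lBase ω), _, _, ?_, ?_, ?_, M.pb (T.lPb ω), M.nil ω, M.cons ω⟩
    · rw [M.dom, lBase, T.cod_left]
    · rw [AUData.list, M.nil, M.dom, M.cod, T.cod_lNil, T.cod_left]
    · rw [M.cod, T.cod_right, T.cod_lPb, M.one]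

/-- Interpretations of the nodes and edges of `T'` that restrict along `i` to the model `M`. -/
structure Extends (M : StrictModel T A) (i : Hom T T') (nd : T'.N → A.Obj) (ed : T'.E → A.Arr) :
    Prop where
  node : ∀ X, nd (i.n X) = M.node X
  edge : ∀ f, ed (i.e f) = M.edge f

theorem extends_of_reduct_eq {M : StrictModel T A} {i : Hom T T'} {M' : StrictModel T' A}
    (h : M'.reduct i = M) : M.Extends i M'.node M'.edge := by
  subst h
  exact ⟨fun _ => rfl, fun _ => rfl⟩

/-- All other fields of a strict model are propositions, so pointwise agreement on nodes and edges
is equality of models. -/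
theorem Extends.reduct_eq {M : StrictModel T A} {i : Hom T T'} {M' : StrictModel T' A}
    (h : M.Extends i M'.node M'.edge) : M'.reduct i = M :=
  StrictModel.ext (funext h.node) (funext h.edge)

/-- The conditions for a strict model, restricted to the elements of a delta. -/
structure HoldsOn (d : Delta T') (nd : T'.N → A.Obj) (ed : T'.E → A.Arr) : Prop where
  dom : ∀ f ∈ d.e, A.dom (ed f) = nd (T'.dom f) := by simp
  cod : ∀ f ∈ d.e, A.cod (ed f) = nd (T'.cod f) := by simp
  id : ∀ X ∈ d.n, A.id (nd X) = ed (T'.id X) := by simp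
  tri : ∀ τ ∈ d.tri, A.Comm (ed (T'.left τ)) (ed (T'.right τ)) (ed (T'.long τ)) := by simp
  one : ∀ ω ∈ d.uOne, nd (T'.one ω) = A.one := by simp
  zero : ∀ ω ∈ d.uZero, nd (T'.zero ω) = A.zero := by simp
  pb : ∀ ω ∈ d.uPb, A.Pb (ed (T'.right (T'.pb₁ ω))) (ed (T'.right (T'.pb₂ ω)))
    (ed (T'.left (T'.pb₁ ω))) (ed (T'.left (T'.pb₂ ω))) := by simp
  po : ∀ ω ∈ d.uPo, A.Po (ed (T'.left (T'.po₁ ω))) (ed (T'.left (T'.po₂ ω)))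
    (ed (T'.right (T'.po₁ ω))) (ed (T'.right (T'.po₂ ω))) := by simp
  nil : ∀ ω ∈ d.uList, A.nil (nd (T'.lBase ω)) = ed (T'.lNil ω) := by simp
  cons : ∀ ω ∈ d.uList, A.cons (nd (T'.lBase ω)) = ed (T'.lCons ω) := by simp

end StrictModel

/-! ### Maps out of a coproduct with finite complement -/

theorem IsCoproduct.forall {X Y : Type u} {f : X → Y} {l : List Y} (h : IsCoproduct f l)
    {P : Y → Prop} (h₁ : ∀ x, P (f x)) (h₂ : ∀ y ∈ l, P y) (y : Y) : P y := by
  by_cases hy : y ∈ l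
  · exact h₂ y hy
  · obtain ⟨x, rfl⟩ := not_not.1 (mt (h.2.2 y).2 hy)
    exact h₁ x

/-- Distinctness of the entries of `l` is what allows their values to be prescribed independently.
-/
theorem exists_map_eq {Y : Type u} {Z : Type v} [Inhabited Z] {l : List Y} (hl : l.Nodup)
    (k : List Z) (h : l.length = k.length) : ∃ f : Y → Z, l.map f = k := by
  classical
  -- Each entry of `l` is sent to the value at its own position in `k`; the default is reached only
  -- outside `l`.
  refine ⟨fun y => k[l.idxOf y]?.getD default, List.ext_getElem (by simpa using h) fun n h₁ h₂ => ?_⟩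
  rw [List.getElem_map, List.Nodup.idxOf_getElem hl, List.getElem?_eq_getElem h₂]
  rfl

/-- A map on a coproduct is given by a map on the first summand and a list of values. -/
theorem IsCoproduct.exists_desc {X Y : Type u} {Z : Type v} [Inhabited Z] {f : X → Y} {l : List Y}
    (h : IsCoproduct f l) (g : X → Z) (k : List Z) (hk : l.length = k.length) :
    ∃ g' : Y → Z, (∀ x, g' (f x) = g x) ∧ l.map g' = k := by
  obtain ⟨k', rfl⟩ := exists_map_eq h.2.1 k hk
  -- `Function.extend` follows `g` on the range of `f` and falls back on `k'` off it, which is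
  -- exactly on the members of `l`.
  refine ⟨Function.extend f g k', h.1.extend_apply _ _, List.map_congr_left fun y hy => ?_⟩
  exact Function.extend_apply' _ _ _ ((h.2.2 y).1 hy)

/-! ### Extending a model over a delta -/

namespace Hom

open StrictModel

variable {T T' : Sketch.{u}} {A : AU.{v}} {i : Hom T T'}

theorem n_lBase (i : Hom T T') (ω : T.UList) : i.n (T.lBase ω) = T'.lBase (i.uList ω) := by
  unfold lBase; rw [i.cod, i.left, i.pb₁, i.lPb]

/-- Every condition on a strict model is indexed by one carrier, and each carrier splits into old
and fresh elements. On old ones the condition is inherited from `M`, since `i` commutes with the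
operations; on fresh ones it is `hd`. -/
theorem Adjoins.exists_model {d : Delta T'} (h : i.Adjoins d) {M : StrictModel T A}
    {nd : T'.N → A.Obj} {ed : T'.E → A.Arr} (hM : M.Extends i nd ed) (hd : HoldsOn d nd ed) :
    ∃ M' : StrictModel T' A, M'.node = nd ∧ M'.edge = ed :=
  ⟨{ node := nd
     edge := ed
     dom := h.e.forall (fun f => by rw [hM.edge, ← i.dom, hM.node, M.dom]) hd.dom
     cod := h.e.forall (fun f => by rw [hM.edge, ← i.cod, hM.node, M.cod]) hd.cod
     id := h.n.forall (fun X => by rw [hM.node, ← i.id, hM.edge, M.id]) hd.id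
     tri := h.tri.forall
       (fun τ => by
         rw [← i.left, ← i.right, ← i.long, hM.edge, hM.edge, hM.edge]; exact M.tri τ) hd.tri
     one := h.uOne.forall (fun ω => by rw [← i.one, hM.node, M.one]) hd.one
     zero := h.uZero.forall (fun ω => by rw [← i.zero, hM.node, M.zero]) hd.zero
     pb := h.uPb.forall
       (fun ω => by
         simp only [← i.pb₁, ← i.pb₂, ← i.left, ← i.right, hM.edge]; exact M.pb ω) hd.pb
     po := h.uPo.forall
       (fun ω => by
         simp only [← i.po₁, ← i.po₂, ← i.left, ← i.right, hM.edge]; exact M.po ω) hd.po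
     nil := h.uList.forall
       (fun ω => by rw [← n_lBase, ← i.lNil, hM.node, hM.edge, M.nil]) hd.nil
     cons := h.uList.forall
       (fun ω => by rw [← n_lBase, ← i.lCons, hM.node, hM.edge, M.cons]) hd.cons }, rfl, rfl⟩

/-- To extend a model along a protoextension is to interpret the nodes and edges of the delta; the
extension is unique if the interpretations are forced. -/
theorem Adjoins.existsUnique {d : Delta T'} (h : i.Adjoins d) (M : StrictModel T A)
    (vn : List A.Obj) (ve : List A.Arr) (hn : d.n.length = vn.length) (he : d.e.length = ve.length)
    (ex : ∀ nd ed, M.Extends i nd ed → d.n.map nd = vn → d.e.map ed = ve → HoldsOn d nd ed)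
    (un : ∀ M' : StrictModel T' A, M.Extends i M'.node M'.edge →
      d.n.map M'.node = vn ∧ d.e.map M'.edge = ve) :
    ∃! M' : StrictModel T' A, M'.reduct i = M := by
  -- Default values for `exists_desc`; they never matter on the coproduct.
  have : Inhabited A.Obj := ⟨A.one⟩
  have : Inhabited A.Arr := ⟨A.id A.one⟩
  obtain ⟨nd, hnd, hnd'⟩ := h.n.exists_desc M.node vn hn
  obtain ⟨ed, hed, hed'⟩ := h.e.exists_desc M.edge ve he
  obtain ⟨M', rfl, rfl⟩ := h.exists_model ⟨hnd, hed⟩ (ex nd ed ⟨hnd, hed⟩ hnd' hed')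
  refine ⟨M', Extends.reduct_eq ⟨hnd, hed⟩, fun M'' h'' => ?_⟩
  have hM := extends_of_reduct_eq h''
  obtain ⟨h₁, h₂⟩ := un M'' hM
  -- Two extensions agree on old elements because both restrict to `M`, and on fresh ones because
  -- both take the listed values.
  refine StrictModel.ext
    (funext <| h.n.forall (fun X => (hM.node X).trans (hnd X).symm)
      (List.map_inj_left.1 (h₁.trans hnd'.symm)))
    (funext <| h.e.forall (fun f => (hM.edge f).trans (hed f).symm)
      (List.map_inj_left.1 (h₂.trans hed'.symm)))

/-! ### Fresh commutativities and inverses -/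

theorem AdjoinsTri.existsUnique {u v w : T.E} (h : i.AdjoinsTri u v w) (M : StrictModel T A)
    (hc : A.Comm (M.edge u) (M.edge v) (M.edge w)) :
    ∃! M' : StrictModel T' A, M'.reduct i = M := by
  obtain ⟨τ, ⟨h₁, h₂, h₃⟩, h⟩ := h
  -- There is nothing to choose, so uniqueness is free. The conditions other than `tri` range over
  -- empty lists and are closed by the default proofs of `HoldsOn`.
  refine h.existsUnique M [] [] rfl rfl (fun nd ed hM _ _ => { tri := ?_ }) fun _ _ => ⟨rfl, rfl⟩
  simp only [List.mem_singleton, forall_eq]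
  rwa [h₁, h₂, h₃, hM.edge, hM.edge, hM.edge]

theorem AdjoinsEqv.existsUnique {u v : T.E} (h : i.AdjoinsEqv u v) (M : StrictModel T A)
    (hc : M.edge u = M.edge v) : ∃! M' : StrictModel T' A, M'.reduct i = M :=
  AdjoinsTri.existsUnique h M <| by
    rw [← M.id, ← M.dom]; exact AU.eqv_of_eq hc

/-- Two-sided inverses are unique, so the value of the fresh edge is forced once the interpretation
of `u` is invertible. -/
theorem AdjoinsInverse.existsUnique {u : T.E} (h : i.AdjoinsInverse u) (M : StrictModel T A)
    (hc : A.toDiag.Invertible (M.edge u)) : ∃! M' : StrictModel T' A, M'.reduct i = M := by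
  obtain ⟨u', τ₁, τ₂, ⟨h₁, h₂, h₃⟩, ⟨k₁, k₂, k₃⟩, h⟩ := h
  obtain ⟨w, hw₁, hw₂⟩ := hc
  refine h.existsUnique M [] [w] rfl rfl (fun nd ed hM _ he => ?_) fun M' hM => ⟨rfl, ?_⟩
  · simp only [List.map_cons, List.map_nil, List.cons.injEq, and_true] at he
    -- The endpoints of the fresh edge are not given separately; they are read off from the shape of
    -- its triangles.
    have c₁ : T'.dom u' = i.n (T.cod u) := by rw [← h₂, ← T'.cod_left, h₁, i.cod]
    have c₂ : T'.cod u' = i.n (T.dom u) := by rw [← k₁, T'.cod_left, k₂, i.dom]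
    constructor <;> simp
    · rw [he, c₁, hM.node, ← M.cod, hw₁.1]
    · rw [he, c₂, hM.node, ← M.dom, hw₂.1]
    · rw [h₁, h₂, h₃, k₁, k₂, k₃, ← i.id, ← i.id, he, hM.edge, hM.edge, hM.edge, ← M.id, ← M.id,
        ← M.dom, ← M.cod]
      exact ⟨hw₁, hw₂⟩
  -- One fresh triangle suffices here: `w` inverts the interpretation of `u` on one side by `hw₂`,
  -- and `τ₁` makes the value of `u'` an inverse on the other.
  · have e₁ := M'.tri τ₁
    rw [h₁, h₂, h₃, ← i.id, hM.edge, hM.edge, ← M.id, ← M.dom] at e₁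
    simp only [List.map_cons, List.map_nil, List.cons.injEq, and_true]
    exact (AU.inv_inj hw₂ e₁).symm

/-! ### Composites, terminal and initial objects -/

theorem existsUnique_comp {u v : T.E} (huv : T.cod u = T.dom v) {x : T'.E} {τ : T'.Tri}
    (hτ : T'.IsTri τ (i.e u) (i.e v) x) (h : i.Adjoins { e := [x], tri := [τ] })
    (M : StrictModel T A) : ∃! M' : StrictModel T' A, M'.reduct i = M := by
  obtain ⟨h₁, h₂, h₃⟩ := hτ
  have e : A.cod (M.edge u) = A.dom (M.edge v) := by rw [M.cod, M.dom, huv]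
  refine h.existsUnique M [] [A.comp (M.edge u) (M.edge v) e] rfl rfl
    (fun nd ed hM _ he => ?_) fun M' hM => ⟨rfl, ?_⟩
  · simp only [List.map_cons, List.map_nil, List.cons.injEq, and_true] at he
    have c₁ : T'.dom x = i.n (T.dom u) := by rw [← h₃, ← T'.dom_left, h₁, i.dom]
    have c₂ : T'.cod x = i.n (T.cod v) := by rw [← h₃, ← T'.cod_right, h₂, i.cod]
    constructor <;> simp
    · rw [he, c₁, hM.node, A.dom_comp, M.dom]
    · rw [he, c₂, hM.node, A.cod_comp, M.cod]
    · rw [h₁, h₂, h₃, he, hM.edge, hM.edge]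
      exact ⟨e, rfl⟩
  · have e₁ := M'.tri τ
    rw [h₁, h₂, h₃, hM.edge, hM.edge] at e₁
    simp only [List.map_cons, List.map_nil, List.cons.injEq, and_true]
    exact AU.comm_inj e₁ ⟨e, rfl⟩

/-- Strictness forces the fresh node to be the chosen terminal object. A fresh node brings its
identity edge into the delta, and the value of that edge is forced in turn. -/
theorem existsUnique_one {ω : T'.UOne} {X : T'.N} (hω : T'.one ω = X)
    (h : i.Adjoins { uOne := [ω], n := [X], e := [T'.id X] })
    (M : StrictModel T A) : ∃! M' : StrictModel T' A, M'.reduct i = M := by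
  refine h.existsUnique M [A.one] [A.id A.one] rfl rfl (fun nd ed hM hn he => ?_) fun M' hM => ?_
  · simp only [List.map_cons, List.map_nil, List.cons.injEq, and_true] at hn he
    constructor <;> simp [hω, hn, he, T'.dom_id, T'.cod_id, A.dom_id, A.cod_id]
  · simp [← M'.id, ← hω, M'.one]

theorem existsUnique_zero {ω : T'.UZero} {X : T'.N} (hω : T'.zero ω = X)
    (h : i.Adjoins { uZero := [ω], n := [X], e := [T'.id X] })
    (M : StrictModel T A) : ∃! M' : StrictModel T' A, M'.reduct i = M := by
  refine h.existsUnique M [A.zero] [A.id A.zero] rfl rfl (fun nd ed hM hn he => ?_) fun M' hM => ?_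
  · simp only [List.map_cons, List.map_nil, List.cons.injEq, and_true] at hn he
    constructor <;> simp [hω, hn, he, T'.dom_id, T'.cod_id, A.dom_id, A.cod_id]
  · simp [← M'.id, ← hω, M'.zero]

/-- This serves the fillins for terminal and initial objects, which come without any commutativity:
the endpoints alone must determine the arrow. -/
theorem existsUnique_edge {X Y : T.N} {x : T'.E} (hX : T'.dom x = i.n X) (hY : T'.cod x = i.n Y)
    (h : i.Adjoins { e := [x] }) (M : StrictModel T A)
    (hM : ∃! f, A.dom f = M.node X ∧ A.cod f = M.node Y) :
    ∃! M' : StrictModel T' A, M'.reduct i = M := by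
  obtain ⟨f, ⟨h₁, h₂⟩, hf⟩ := hM
  refine h.existsUnique M [] [f] rfl rfl (fun nd ed hM _ he => ?_) fun M' hM => ⟨rfl, ?_⟩
  · simp only [List.map_cons, List.map_nil, List.cons.injEq, and_true] at he
    constructor <;> simp [he, hX, hY, hM.node, h₁, h₂]
  · simp only [List.map_cons, List.map_nil, List.cons.injEq, and_true]
    exact hf _ ⟨by rw [M'.dom, hX, hM.node], by rw [M'.cod, hY, hM.node]⟩

/-! ### Pullbacks, pushouts and their fillins -/

/-- The universal forces the projections to be the canonical ones. The diagonal is then forced as a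
composite, the vertex as the domain of the diagonal, and the last edge as the identity of the
vertex. -/
theorem existsUnique_pb {u₁ u₂ : T.E} (hu : T.cod u₁ = T.cod u₂)
    {ω : T'.UPb} {τ₁ τ₂ : T'.Tri} {p₁ p p₂ : T'.E} {P : T'.N}
    (hω₁ : T'.pb₁ ω = τ₁) (hω₂ : T'.pb₂ ω = τ₂)
    (hτ₁ : T'.IsTri τ₁ p₁ (i.e u₁) p) (hτ₂ : T'.IsTri τ₂ p₂ (i.e u₂) p) (hP : T'.dom p = P)
    (h : i.Adjoins { uPb := [ω], tri := [τ₁, τ₂], e := [p₁, p, p₂, T'.id P], n := [P] })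
    (M : StrictModel T A) : ∃! M' : StrictModel T' A, M'.reduct i = M := by
  obtain ⟨h₁, h₂, h₃⟩ := hτ₁
  obtain ⟨k₁, k₂, k₃⟩ := hτ₂
  have e : A.cod (M.edge u₁) = A.cod (M.edge u₂) := by rw [M.cod, M.cod, hu]
  obtain ⟨q₁, q₂, hq⟩ : ∃ q₁ q₂, A.Pb (M.edge u₁) (M.edge u₂) q₁ q₂ := ⟨_, _, e, rfl, rfl⟩
  obtain ⟨q, hq₁, hq₂⟩ := A.pb_cone hq
  refine h.existsUnique M [A.dom q] [q₁, q, q₂, A.id (A.dom q)] rfl rfl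
    (fun nd ed hM hn he => ?_) fun M' hM => ?_
  · simp only [List.map_cons, List.map_nil, List.cons.injEq, and_true] at hn he
    obtain ⟨e₁, e₂, e₃, e₄⟩ := he
    have c₁ : T'.dom p₁ = P := by rw [← hP, ← h₃, ← T'.dom_left, h₁]
    have c₂ : T'.dom p₂ = P := by rw [← hP, ← k₃, ← T'.dom_left, k₁]
    have c₃ : T'.cod p₁ = i.n (T.dom u₁) := by rw [← h₁, T'.cod_left, h₂, i.dom]
    have c₄ : T'.cod p₂ = i.n (T.dom u₂) := by rw [← k₁, T'.cod_left, k₂, i.dom]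
    have c₅ : T'.cod p = i.n (T.cod u₁) := by rw [← h₃, ← T'.cod_right, h₂, i.cod]
    constructor <;> simp
    · rw [e₁, e₂, e₃, e₄, c₁, c₂, hP, T'.dom_id, hn, A.dom_id]
      exact ⟨(AU.comm_dom hq₁).symm, rfl, (AU.comm_dom hq₂).symm, rfl⟩
    · rw [e₁, e₂, e₃, e₄, c₃, c₄, c₅, T'.cod_id, hn, A.cod_id, hM.node, hM.node, hM.node,
        ← M.dom, ← M.dom, ← M.cod]
      exact ⟨hq₁.1, AU.comm_cod hq₁, hq₂.1, rfl⟩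
    · rw [e₄, hn]
    · rw [h₁, h₂, h₃, k₁, k₂, k₃, e₁, e₂, e₃, hM.edge, hM.edge]
      exact ⟨hq₁, hq₂⟩
    · rw [hω₁, hω₂, h₁, h₂, k₁, k₂, e₁, e₃, hM.edge, hM.edge]
      exact hq
  · have e₁ := M'.pb ω
    have e₂ := M'.tri τ₁
    rw [hω₁, hω₂, h₁, h₂, k₁, k₂, hM.edge, hM.edge] at e₁
    rw [h₁, h₂, h₃, hM.edge] at e₂
    obtain ⟨e₃, e₄⟩ := AU.pb_inj e₁ hq
    rw [e₃] at e₂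
    have e₅ := AU.comm_inj e₂ hq₁
    -- The vertex has no operator of its own in `AUData`; it is recovered from the diagonal.
    have e₆ : M'.node P = A.dom q := by rw [← hP, ← M'.dom, e₅]
    simp [e₃, e₄, e₅, e₆, ← M'.id]

theorem existsUnique_po {u₁ u₂ : T.E} (hu : T.dom u₁ = T.dom u₂)
    {ω : T'.UPo} {τ₁ τ₂ : T'.Tri} {p₁ p p₂ : T'.E} {P : T'.N}
    (hω₁ : T'.po₁ ω = τ₁) (hω₂ : T'.po₂ ω = τ₂)
    (hτ₁ : T'.IsTri τ₁ (i.e u₁) p₁ p) (hτ₂ : T'.IsTri τ₂ (i.e u₂) p₂ p) (hP : T'.cod p = P)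
    (h : i.Adjoins { uPo := [ω], tri := [τ₁, τ₂], e := [p₁, p, p₂, T'.id P], n := [P] })
    (M : StrictModel T A) : ∃! M' : StrictModel T' A, M'.reduct i = M := by
  obtain ⟨h₁, h₂, h₃⟩ := hτ₁
  obtain ⟨k₁, k₂, k₃⟩ := hτ₂
  have e : A.dom (M.edge u₁) = A.dom (M.edge u₂) := by rw [M.dom, M.dom, hu]
  obtain ⟨q₁, q₂, hq⟩ : ∃ q₁ q₂, A.Po (M.edge u₁) (M.edge u₂) q₁ q₂ := ⟨_, _, e, rfl, rfl⟩
  obtain ⟨q, hq₁, hq₂⟩ := A.po_cocone hq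
  refine h.existsUnique M [A.cod q] [q₁, q, q₂, A.id (A.cod q)] rfl rfl
    (fun nd ed hM hn he => ?_) fun M' hM => ?_
  · simp only [List.map_cons, List.map_nil, List.cons.injEq, and_true] at hn he
    obtain ⟨e₁, e₂, e₃, e₄⟩ := he
    have c₁ : T'.cod p₁ = P := by rw [← hP, ← h₃, ← T'.cod_right, h₂]
    have c₂ : T'.cod p₂ = P := by rw [← hP, ← k₃, ← T'.cod_right, k₂]
    have c₃ : T'.dom p₁ = i.n (T.cod u₁) := by rw [← h₂, ← T'.cod_left, h₁, i.cod]
    have c₄ : T'.dom p₂ = i.n (T.cod u₂) := by rw [← k₂, ← T'.cod_left, k₁, i.cod]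
    have c₅ : T'.dom p = i.n (T.dom u₁) := by rw [← h₃, ← T'.dom_left, h₁, i.dom]
    constructor <;> simp
    · rw [e₁, e₂, e₃, e₄, c₃, c₄, c₅, T'.dom_id, hn, A.dom_id, hM.node, hM.node, hM.node,
        ← M.cod, ← M.cod, ← M.dom]
      exact ⟨hq₁.1.symm, AU.comm_dom hq₁, hq₂.1.symm, rfl⟩
    · rw [e₁, e₂, e₃, e₄, c₁, c₂, hP, T'.cod_id, hn, A.cod_id]
      exact ⟨(AU.comm_cod hq₁).symm, rfl, (AU.comm_cod hq₂).symm, rfl⟩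
    · rw [e₄, hn]
    · rw [h₁, h₂, h₃, k₁, k₂, k₃, e₁, e₂, e₃, hM.edge, hM.edge]
      exact ⟨hq₁, hq₂⟩
    · rw [hω₁, hω₂, h₁, h₂, k₁, k₂, e₁, e₃, hM.edge, hM.edge]
      exact hq
  · have e₁ := M'.po ω
    have e₂ := M'.tri τ₁
    rw [hω₁, hω₂, h₁, h₂, k₁, k₂, hM.edge, hM.edge] at e₁
    rw [h₁, h₂, h₃, hM.edge] at e₂
    obtain ⟨e₃, e₄⟩ := AU.po_inj e₁ hq
    rw [e₃] at e₂
    have e₅ := AU.comm_inj e₂ hq₁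
    have e₆ : M'.node P = A.cod q := by rw [← hP, ← M'.cod, e₅]
    simp [e₃, e₄, e₅, e₆, ← M'.id]

theorem existsUnique_pbFill {ω : T.UPb} {Δ₁ Δ₂ : T.Tri} (hΔ₁ : T.right Δ₁ = T.right (T.pb₁ ω))
    (hΔ₂ : T.right Δ₂ = T.right (T.pb₂ ω)) (hΔ : T.long Δ₁ = T.long Δ₂)
    {x : T'.E} {τ₁ τ₂ : T'.Tri}
    (hτ₁ : T'.IsTri τ₁ x (i.e (T.left (T.pb₁ ω))) (i.e (T.left Δ₁)))
    (hτ₂ : T'.IsTri τ₂ x (i.e (T.left (T.pb₂ ω))) (i.e (T.left Δ₂)))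
    (h : i.Adjoins { e := [x], tri := [τ₁, τ₂] })
    (M : StrictModel T A) : ∃! M' : StrictModel T' A, M'.reduct i = M := by
  obtain ⟨h₁, h₂, h₃⟩ := hτ₁
  obtain ⟨k₁, k₂, k₃⟩ := hτ₂
  have m₁ := M.tri Δ₁
  have m₂ := M.tri Δ₂
  -- The two triangles share their long edge, so their left edges form a cone over the cospan of
  -- `ω`.
  rw [hΔ₁, hΔ] at m₁
  rw [hΔ₂] at m₂
  obtain ⟨k, ⟨hk₁, hk₂⟩, hk⟩ := A.pb_lift (M.pb ω) m₁ m₂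
  refine h.existsUnique M [] [k] rfl rfl (fun nd ed hM _ he => ?_) fun M' hM => ⟨rfl, ?_⟩
  · simp only [List.map_cons, List.map_nil, List.cons.injEq, and_true] at he
    have c₁ : T'.dom x = i.n (T.dom (T.left Δ₁)) := by rw [← h₁, T'.dom_left, h₃, i.dom]
    have c₂ : T'.cod x = i.n (T.dom (T.left (T.pb₁ ω))) := by rw [← h₁, T'.cod_left, h₂, i.dom]
    constructor <;> simp
    · rw [he, c₁, hM.node, ← M.dom, AU.comm_dom hk₁]
    · rw [he, c₂, hM.node, ← M.dom, hk₁.1]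
    · simp only [h₁, h₂, h₃, k₁, k₂, k₃, he, hM.edge]
      exact ⟨hk₁, hk₂⟩
  · have e₁ := M'.tri τ₁
    have e₂ := M'.tri τ₂
    rw [h₁, h₂, h₃, hM.edge, hM.edge] at e₁
    rw [k₁, k₂, k₃, hM.edge, hM.edge] at e₂
    simpa using hk _ ⟨e₁, e₂⟩

theorem existsUnique_poFill {ω : T.UPo} {Δ₁ Δ₂ : T.Tri} (hΔ₁ : T.left Δ₁ = T.left (T.po₁ ω))
    (hΔ₂ : T.left Δ₂ = T.left (T.po₂ ω)) (hΔ : T.long Δ₁ = T.long Δ₂)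
    {x : T'.E} {τ₁ τ₂ : T'.Tri}
    (hτ₁ : T'.IsTri τ₁ (i.e (T.right (T.po₁ ω))) x (i.e (T.right Δ₁)))
    (hτ₂ : T'.IsTri τ₂ (i.e (T.right (T.po₂ ω))) x (i.e (T.right Δ₂)))
    (h : i.Adjoins { e := [x], tri := [τ₁, τ₂] })
    (M : StrictModel T A) : ∃! M' : StrictModel T' A, M'.reduct i = M := by
  obtain ⟨h₁, h₂, h₃⟩ := hτ₁
  obtain ⟨k₁, k₂, k₃⟩ := hτ₂
  have m₁ := M.tri Δ₁
  have m₂ := M.tri Δ₂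
  -- Dually, the right edges of the two triangles form a cocone under the span of `ω`.
  rw [hΔ₁, hΔ] at m₁
  rw [hΔ₂] at m₂
  obtain ⟨k, ⟨hk₁, hk₂⟩, hk⟩ := A.po_desc (M.po ω) m₁ m₂
  refine h.existsUnique M [] [k] rfl rfl (fun nd ed hM _ he => ?_) fun M' hM => ⟨rfl, ?_⟩
  · simp only [List.map_cons, List.map_nil, List.cons.injEq, and_true] at he
    have c₁ : T'.cod x = i.n (T.cod (T.right Δ₁)) := by rw [← h₂, T'.cod_right, h₃, i.cod]
    have c₂ : T'.dom x = i.n (T.cod (T.right (T.po₁ ω))) := by rw [← h₂, ← T'.cod_left, h₁, i.cod]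
    constructor <;> simp
    · rw [he, c₂, hM.node, ← M.cod, hk₁.1]
    · rw [he, c₁, hM.node, ← M.cod, AU.comm_cod hk₁]
    · simp only [h₁, h₂, h₃, k₁, k₂, k₃, he, hM.edge]
      exact ⟨hk₁, hk₂⟩
  · have e₁ := M'.tri τ₁
    have e₂ := M'.tri τ₂
    rw [h₁, h₂, h₃, hM.edge, hM.edge] at e₁
    rw [k₁, k₂, k₃, hM.edge, hM.edge] at e₂
    simpa using hk _ ⟨e₁, e₂⟩

/-! ### List objects and recursion -/

/-- The values are forced in a definite order: the terminal node, the maps `ε` and `c`, the node `L`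
as codomain of `ε`, the two edges into the terminal object, and finally the product of base and list
object, as for a fresh pullback. -/
theorem existsUnique_list {X : T.N} {ω : T'.UList} {ωOne : T'.UOne} {ωPb : T'.UPb}
    {τ₁ τ₂ : T'.Tri} {ε c p₁ p p₂ bangA bangL : T'.E} {I L P : T'.N}
    (hOne : T'.lOne ω = ωOne) (hPb : T'.lPb ω = ωPb) (hε : T'.lNil ω = ε) (hc : T'.lCons ω = c)
    (hI : T'.one ωOne = I) (hω₁ : T'.pb₁ ωPb = τ₁) (hω₂ : T'.pb₂ ωPb = τ₂)
    (hτ₁ : T'.IsTri τ₁ p₁ bangA p) (hτ₂ : T'.IsTri τ₂ p₂ bangL p)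
    (hA : T'.dom bangA = i.n X) (hL : T'.dom bangL = L) (hP : T'.dom p = P)
    (h : i.Adjoins
      { uList := [ω], uOne := [ωOne], uPb := [ωPb], tri := [τ₁, τ₂],
        e := [ε, c, p₁, p, p₂, bangA, bangL, T'.id I, T'.id L, T'.id P], n := [I, L, P] })
    (M : StrictModel T A) : ∃! M' : StrictModel T' A, M'.reduct i = M := by
  obtain ⟨h₁, h₂, h₃⟩ := hτ₁
  obtain ⟨k₁, k₂, k₃⟩ := hτ₂
  -- The sketch axioms on list universals and triangles fix the endpoints of all fresh edges.
  have dε : T'.dom ε = I := by rw [← hε, T'.dom_lNil, hOne, hI]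
  have cp₁ : T'.cod p₁ = i.n X := by rw [← h₁, T'.cod_left, h₂, hA]
  have cp₂ : T'.cod p₂ = L := by rw [← k₁, T'.cod_left, k₂, hL]
  have dp₁ : T'.dom p₁ = P := by rw [← h₁, T'.dom_left, h₃, hP]
  have dp₂ : T'.dom p₂ = P := by rw [← k₁, T'.dom_left, k₃, hP]
  have cε : T'.cod ε = L := by rw [← hε, T'.cod_lNil, hPb, hω₂, k₁, cp₂]
  have dc : T'.dom c = P := by rw [← hc, T'.dom_lCons, hPb, hω₁, h₁, dp₁]
  have cc : T'.cod c = L := by rw [← hc, T'.cod_lCons, hPb, hω₂, k₁, cp₂]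
  have cp : T'.cod p = I := by rw [← h₃, ← hω₁, ← hPb, T'.cod_lPb, hOne, hI]
  have cA : T'.cod bangA = I := by rw [← cp, ← h₃, ← T'.cod_right, h₂]
  have cL : T'.cod bangL = I := by rw [← cp, ← k₃, ← T'.cod_right, k₂]
  have hB : T'.lBase ω = i.n X := by rw [lBase, hPb, hω₁, h₁, cp₁]
  obtain ⟨f, ⟨f₁, f₂⟩, hf⟩ := A.one_lift (M.node X)
  obtain ⟨g, ⟨g₁, g₂⟩, hg⟩ := A.one_lift (A.list (M.node X))
  obtain ⟨q₁, q₂, hq⟩ : ∃ q₁ q₂, A.Pb f g q₁ q₂ := ⟨_, _, f₂.trans g₂.symm, rfl, rfl⟩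
  obtain ⟨q, hq₁, hq₂⟩ := A.pb_cone hq
  refine h.existsUnique M [A.one, A.list (M.node X), A.dom q]
    [A.nil (M.node X), A.cons (M.node X), q₁, q, q₂, f, g, A.id A.one, A.id (A.list (M.node X)),
      A.id (A.dom q)] rfl rfl
    (fun nd ed hM hn he => ?_) fun M' hM => ?_
  · simp only [List.map_cons, List.map_nil, List.cons.injEq, and_true] at hn he
    obtain ⟨n₁, n₂, n₃⟩ := hn
    obtain ⟨e₁, e₂, e₃, e₄, e₅, e₆, e₇, e₈, e₉, e₀⟩ := he
    -- The pullback over the terminal object is a product in the sense of `IsProd`, so `dom_cons`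
    -- makes the canonical `cons` start at its vertex.
    have dq : A.dom (A.cons (M.node X)) = A.dom q :=
      (A.dom_cons _ _ _ ⟨f, g, f₁, g₁, f₂, hq⟩).trans (AU.comm_dom hq₁).symm
    constructor <;> simp
    · simp only [e₁, e₂, e₃, e₄, e₅, e₆, e₇, e₈, e₉, e₀, dε, dc, dp₁, dp₂, hP, hA, hL, hM.node,
        T'.dom_id, n₁, n₂, n₃, A.dom_id, A.dom_nil, f₁, g₁, dq, ← AU.comm_dom hq₁, ← AU.comm_dom hq₂,
        and_self]
    · simp only [e₁, e₂, e₃, e₄, e₅, e₆, e₇, e₈, e₉, e₀, cε, cc, cp₁, cp₂, cp, cA, cL, hM.node,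
        T'.cod_id, n₁, n₂, n₃, A.cod_id, A.cod_cons, f₂, g₂, hq₁.1, hq₂.1, f₁, g₁,
        AU.comm_cod hq₁, and_self, and_true]
      rfl
    · simp only [e₈, e₉, e₀, n₁, n₂, n₃, and_self]
    · simp only [h₁, h₂, h₃, k₁, k₂, k₃, e₃, e₄, e₅, e₆, e₇]
      exact ⟨hq₁, hq₂⟩
    · rw [hI, n₁]
    · rw [hω₁, hω₂, h₁, h₂, k₁, k₂, e₃, e₅, e₆, e₇]
      exact hq
    · rw [hB, hε, e₁, hM.node]
    · rw [hB, hc, e₂, hM.node]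
  · have nI : M'.node I = A.one := by rw [← hI, M'.one]
    have eε : M'.edge ε = A.nil (M.node X) := by rw [← hε, ← M'.nil, hB, hM.node]
    have ec : M'.edge c = A.cons (M.node X) := by rw [← hc, ← M'.cons, hB, hM.node]
    have nL : M'.node L = A.list (M.node X) := by rw [← cε, ← M'.cod, eε]; rfl
    have eA : M'.edge bangA = f := hf _ ⟨by rw [M'.dom, hA, hM.node], by rw [M'.cod, cA, nI]⟩
    have eL : M'.edge bangL = g := hg _ ⟨by rw [M'.dom, hL, nL], by rw [M'.cod, cL, nI]⟩
    have e₁ := M'.pb ωPb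
    have e₂ := M'.tri τ₁
    rw [hω₁, hω₂, h₁, h₂, k₁, k₂, eA, eL] at e₁
    rw [h₁, h₂, h₃, eA] at e₂
    obtain ⟨e₃, e₄⟩ := AU.pb_inj e₁ hq
    rw [e₃] at e₂
    have e₅ := AU.comm_inj e₂ hq₁
    have nP : M'.node P = A.dom q := by rw [← hP, ← M'.dom, e₅]
    simp [e₃, e₄, e₅, eε, ec, eA, eL, nI, nL, nP, ← M'.id]

/-- `list_rec` determines `r` only; the auxiliary edges are then forced by the equations: `r''` and
`g''` are composites with `r`, `r'` is given by its two components in a product, and `g'` is the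
composite of `r'` with `g`. -/
theorem existsUnique_listFill {κ : T.toDiag.ListConfig} {r r' r'' g' g'' : T'.E}
    {τ₁ τ₂ τ₃ τ₄ τ₅ τ₆ τ₇ : T'.Tri}
    (h₁ : T'.IsTri τ₁ (i.e κ.n) r (i.e κ.y)) (h₂ : T'.IsTri τ₂ (i.e κ.cB) r g'')
    (h₃ : T'.IsTri τ₃ (i.e κ.α) g' g'') (h₄ : T'.IsTri τ₄ r' (i.e κ.g) g')
    (h₅ : T'.IsTri τ₅ (i.e κ.a₂) r r'') (h₆ : T'.IsTri τ₆ r' (i.e κ.m₁) (i.e κ.a₁))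
    (h₇ : T'.IsTri τ₇ r' (i.e κ.m₂) r'')
    (h : i.Adjoins { e := [r, r', r'', g', g''], tri := [τ₁, τ₂, τ₃, τ₄, τ₅, τ₆, τ₇] })
    (M : StrictModel T A) : ∃! M' : StrictModel T' A, M'.reduct i = M := by
  obtain ⟨s, ⟨s', s'', k', k'', hs⟩, hu⟩ := A.list_rec (M.toDiagHom.mapList κ)
  obtain ⟨a₁, b₁, c₁⟩ := h₁
  obtain ⟨a₂, b₂, c₂⟩ := h₂
  obtain ⟨a₃, b₃, c₃⟩ := h₃
  obtain ⟨a₄, b₄, c₄⟩ := h₄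
  obtain ⟨a₅, b₅, c₅⟩ := h₅
  obtain ⟨a₆, b₆, c₆⟩ := h₆
  obtain ⟨a₇, b₇, c₇⟩ := h₇
  refine h.existsUnique M [] [s, s', s'', k', k''] rfl rfl
    (fun nd ed hM _ he => ?_) fun M' hM => ⟨rfl, ?_⟩
  · simp only [List.map_cons, List.map_nil, List.cons.injEq, and_true] at he
    obtain ⟨e₁, e₂, e₃, e₄, e₅⟩ := he
    -- Each endpoint of a fresh edge is traced through a triangle to a node of `T`.
    have dr : T'.dom r = i.n (T.cod κ.n) := by rw [← b₁, ← T'.cod_left, a₁, i.cod]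
    have cr : T'.cod r = i.n (T.cod κ.y) := by rw [← b₁, T'.cod_right, c₁, i.cod]
    have dr' : T'.dom r' = i.n (T.dom κ.a₁) := by rw [← a₆, T'.dom_left, c₆, i.dom]
    have cr' : T'.cod r' = i.n (T.dom κ.m₁) := by rw [← a₆, T'.cod_left, b₆, i.dom]
    have dr'' : T'.dom r'' = i.n (T.dom κ.a₂) := by rw [← c₅, ← T'.dom_left, a₅, i.dom]
    have cr'' : T'.cod r'' = i.n (T.cod κ.m₂) := by rw [← c₇, ← T'.cod_right, b₇, i.cod]
    have dg' : T'.dom g' = i.n (T.cod κ.α) := by rw [← b₃, ← T'.cod_left, a₃, i.cod]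
    have cg' : T'.cod g' = i.n (T.cod κ.g) := by rw [← c₄, ← T'.cod_right, b₄, i.cod]
    have dg'' : T'.dom g'' = i.n (T.dom κ.cB) := by rw [← c₂, ← T'.dom_left, a₂, i.dom]
    have cg'' : T'.cod g'' = i.n (T.cod κ.y) := by rw [← c₂, ← T'.cod_right, b₂, cr]
    constructor <;> simp
    · rw [e₁, e₂, e₃, e₄, e₅, dr, dr', dr'', dg', dg'']
      simp only [hM.node, ← M.dom, ← M.cod]
      exact ⟨hs.nil.1.symm, (AU.comm_dom hs.fst').symm, AU.comm_dom hs.snd, hs.cons'.1.symm,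
        AU.comm_dom hs.cons⟩
    · rw [e₁, e₂, e₃, e₄, e₅, cr, cr', cr'', cg', cg'']
      simp only [hM.node, ← M.dom, ← M.cod]
      exact ⟨(AU.comm_cod hs.nil).symm, hs.fst'.1, AU.comm_cod hs.snd', AU.comm_cod hs.step,
        (AU.comm_cod hs.cons).trans (AU.comm_cod hs.nil).symm⟩
    · simp only [a₁, b₁, c₁, a₂, b₂, c₂, a₃, b₃, c₃, a₄, b₄, c₄, a₅, b₅, c₅, a₆, b₆, c₆, a₇, b₇,
        c₇, e₁, e₂, e₃, e₄, e₅, hM.edge]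
      exact ⟨hs.nil, hs.cons, hs.cons', hs.step, hs.snd, hs.fst', hs.snd'⟩
  · have t₁ := M'.tri τ₁
    have t₂ := M'.tri τ₂
    have t₃ := M'.tri τ₃
    have t₄ := M'.tri τ₄
    have t₅ := M'.tri τ₅
    have t₆ := M'.tri τ₆
    have t₇ := M'.tri τ₇
    simp only [a₁, b₁, c₁, a₂, b₂, c₂, a₃, b₃, c₃, a₄, b₄, c₄, a₅, b₅, c₅, a₆, b₆, c₆, a₇, b₇,
      c₇, hM.edge] at t₁ t₂ t₃ t₄ t₅ t₆ t₇
    have er : M'.edge r = s := hu _ ⟨_, _, _, _, t₁, t₂, t₃, t₄, t₅, t₆, t₇⟩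
    rw [er] at t₂ t₅
    have er'' := AU.comm_inj t₅ hs.snd
    have eg'' := AU.comm_inj t₂ hs.cons
    rw [er''] at t₇
    -- The product is a pullback over a terminal object, so `m₁` and `m₂` are jointly monic.
    obtain ⟨_, _, -, -, -, hm⟩ := (M.toDiagHom.mapList κ).prodAY
    have er' := AU.pb_hom_ext hm t₆ t₇ hs.fst' hs.snd'
    rw [er'] at t₄
    have eg' := AU.comm_inj t₄ hs.step
    simp [er, er', er'', eg', eg'']

/-! ### Unique extension along equivalence extensions -/

/-- Strict models extend uniquely along simple equivalence extensions. -/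
theorem IsSimpleEquivExt.existsUnique (h : i.IsSimpleEquivExt) (M : StrictModel T A) :
    ∃! M' : StrictModel T' A, M'.reduct i = M := by
  have comm {a b c : T.E} (h : T.toDiag.Comm a b c) : A.Comm (M.edge a) (M.edge b) (M.edge c) :=
    M.toDiagHom.comm h
  cases h with
  | comp u v huv x τ hτ h => exact existsUnique_comp huv hτ h M
  | leftUnit u h =>
    exact AdjoinsTri.existsUnique h M (by rw [← M.id, ← M.dom]; exact A.id_comp _)
  | rightUnit u h =>
    exact AdjoinsTri.existsUnique h M (by rw [← M.id, ← M.cod]; exact A.comp_id _)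
  | leftAssoc u v x k l m h₁ h₂ h₃ h =>
    exact AdjoinsTri.existsUnique h M (AU.assoc' (comm h₁) (comm h₂) (comm h₃))
  | rightAssoc u v x k l m h₁ h₂ h₃ h =>
    exact AdjoinsTri.existsUnique h M (A.assoc (comm h₁) (comm h₂) (comm h₃))
  | one ω X hω h => exact existsUnique_one hω h M
  | oneFill ω X x hX hY h =>
    exact existsUnique_edge hX hY h M (by rw [M.one]; exact A.one_lift _)
  | oneUnique ω x x' h₁ h₂ h₃ h =>
    exact AdjoinsEqv.existsUnique h M ((A.one_lift (M.node (T.dom x))).unique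
      ⟨M.dom x, by rw [M.cod, h₂, M.one]⟩ ⟨by rw [M.dom, h₁], by rw [M.cod, h₃, M.one]⟩)
  | pb u₁ u₂ hu ω τ₁ τ₂ p₁ p p₂ P h₁ h₂ h₃ h₄ h₅ h =>
    exact existsUnique_pb hu h₁ h₂ h₃ h₄ h₅ h M
  | pbFill ω Δ₁ Δ₂ h₁ h₂ h₃ x τ₁ τ₂ h₄ h₅ h => exact existsUnique_pbFill h₁ h₂ h₃ h₄ h₅ h M
  | pbUnique ω v₁ v₂ x x' h₁ h₂ h₃ h₄ h =>
    exact AdjoinsEqv.existsUnique h M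
      (AU.pb_hom_ext (M.pb ω) (comm h₁) (comm h₂) (comm h₃) (comm h₄))
  | zero ω X hω h => exact existsUnique_zero hω h M
  | zeroFill ω X x hX hY h =>
    exact existsUnique_edge hX hY h M (by rw [M.zero]; exact A.zero_desc _)
  | zeroUnique ω x x' h₁ h₂ h₃ h =>
    exact AdjoinsEqv.existsUnique h M ((A.zero_desc (M.node (T.cod x))).unique
      ⟨by rw [M.dom, h₂, M.zero], M.cod x⟩ ⟨by rw [M.dom, h₃, M.zero], by rw [M.cod, h₁]⟩)
  | po u₁ u₂ hu ω τ₁ τ₂ p₁ p p₂ P h₁ h₂ h₃ h₄ h₅ h =>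
    exact existsUnique_po hu h₁ h₂ h₃ h₄ h₅ h M
  | poFill ω Δ₁ Δ₂ h₁ h₂ h₃ x τ₁ τ₂ h₄ h₅ h => exact existsUnique_poFill h₁ h₂ h₃ h₄ h₅ h M
  | poUnique ω v₁ v₂ x x' h₁ h₂ h₃ h₄ h =>
    exact AdjoinsEqv.existsUnique h M
      (AU.po_hom_ext (M.po ω) (comm h₁) (comm h₂) (comm h₃) (comm h₄))
  | list X ω ωOne ωPb τ₁ τ₂ ε c p₁ p p₂ bangA bangL I L P h₁ h₂ h₃ h₄ h₅ h₆ h₇ h₈ h₉ hA hL hP h =>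
    exact existsUnique_list h₁ h₂ h₃ h₄ h₅ h₆ h₇ h₈ h₉ hA hL hP h M
  | listFill κ r r' r'' g' g'' τ₁ τ₂ τ₃ τ₄ τ₅ τ₆ τ₇ h₁ h₂ h₃ h₄ h₅ h₆ h₇ h =>
    exact existsUnique_listFill h₁ h₂ h₃ h₄ h₅ h₆ h₇ h M
  | listUnique κ r₁ r₂ h₁ h₂ h =>
    exact AdjoinsEqv.existsUnique h M
      ((A.list_rec _).unique (M.toDiagHom.isRec h₁) (M.toDiagHom.isRec h₂))
  | balance κ h => exact AdjoinsInverse.existsUnique h M (A.balance (M.toDiagHom.mapBalance κ))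
  | zeroStable ω u hu h =>
    exact AdjoinsInverse.existsUnique h M (A.zero_stable _ (by rw [M.cod, hu, M.zero]))
  | poStable κ h =>
    exact AdjoinsInverse.existsUnique h M (A.po_stable (M.toDiagHom.mapPushoutStab κ))
  | exact κ h => exact AdjoinsInverse.existsUnique h M (A.exact (M.toDiagHom.mapExact κ))

theorem IsEquivExtComposite.existsUnique {T T' : Sketch.{u}} {i : Hom T T'}
    (h : i.IsEquivExtComposite) (M : StrictModel T A) :
    ∃! M' : StrictModel T' A, M'.reduct i = M := by
  induction h with
  | refl => exact ⟨M, rfl, fun _ h => h⟩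
  | step i j _ hj ih =>
    obtain ⟨M₁, h₁, u₁⟩ := ih
    obtain ⟨M₂, h₂, u₂⟩ := hj.existsUnique M₁
    -- Reduct along a composite is the iterated reduct by definition, so the intermediate reduct of
    -- any extension is `M₁`, and the extension itself is then `M₂`.
    exact ⟨M₂, by subst h₁ h₂; rfl, fun M' h' => u₂ M' (u₁ (M'.reduct j) h')⟩

/-- This is why equality of sketch homomorphisms may ignore commutativities and universals: the data
of a reduct involve only nodes and edges. -/
theorem Agree.reduct_eq {i j : Hom T T'} (h : i.Agree j) (M : StrictModel T' A) :
    M.reduct i = M.reduct j :=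
  StrictModel.ext (funext fun X => congrArg M.node (congrFun h.1 X))
    (funext fun f => congrArg M.edge (congrFun h.2 f))

/-- Strict models extend uniquely along equivalence extensions. -/
theorem IsEquivExt.existsUnique (h : i.IsEquivExt) (M : StrictModel T A) :
    ∃! M' : StrictModel T' A, M'.reduct i = M := by
  obtain ⟨-, j, hj, hij⟩ := h
  simpa only [hij.reduct_eq] using hj.existsUnique M

end Hom

end Sketch

/-! ### The induced functor between presented arithmetic universes -/

namespace AUPres

/-- `AU⟨e⟩` is an isomorphism if strict models extend uniquely along `e`. -/
theorem isIso_map {T T' : Sketch.{u}} (e : Sketch.Hom T T')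
    (h : ∀ (A : AU.{u}) (M : StrictModel T A), ∃! M' : StrictModel T' A, M'.reduct e = M) :
    IsIso (map e) := by
  -- `M'` is a model of `T'` in `AUPres T`; the strict functor that it classifies is the inverse.
  obtain ⟨M', hM', -⟩ := h _ (generic T)
  have hmap : (generic T).map (map e) = (generic T').reduct e := generic_map_lift _
  refine ⟨lift M', (existsUnique_lift (generic T)).unique ?_ rfl,
    (existsUnique_lift (generic T')).unique ?_ rfl⟩
  -- By the universal property each composite need only be compared with the identity on the generic
  -- model. Taking images commutes definitionally with composing functors and with taking reducts.
  · change ((generic T).map (map e)).map (lift M') = generic T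
    rw [hmap]
    change ((generic T').map (lift M')).reduct e = generic T
    rw [generic_map_lift, hM']
  · change ((generic T').map (lift M')).map (map e) = generic T'
    rw [generic_map_lift]
    -- The generic model of `T'` and its image under the composite have the same reduct along `e`,
    -- so unique extension in `AUPres T'` identifies them.
    refine (h _ ((generic T').reduct e)).unique ?_ rfl
    change (M'.reduct e).map (map e) = _
    rw [hM', hmap]

end AUPres

end ArithUniv

theorem mainTheorem8 {T T' : ArithUniv.Sketch.{u}} (e : ArithUniv.Sketch.Hom T T')
    (he : e.IsEquivExt) :
    (∀ (A : ArithUniv.AU.{v}) (M : ArithUniv.Sketch.StrictModel T A),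
      ∃! M' : ArithUniv.Sketch.StrictModel T' A, M'.reduct e = M) ∧
    CategoryTheory.IsIso (ArithUniv.AUPres.map e) :=
  -- Unique extension is used at two universe levels: at `v` for the models, and at `u`, where the
  -- presented arithmetic universes live.
  ⟨fun _ M => he.existsUnique M, ArithUniv.AUPres.isIso_map e fun _ M => he.existsUnique M⟩
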